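/- Let $0<a<b<1$ with $b<(a+2)/3$ and $b<(2+\sqrt3)\,a$, and let $k>0$. Put $D(u)=(u-a)(u-b)$, $\Phi(u)=\int_1^u D(v)\,dv$, $R(u)=\left(\frac{k^2D(0)}{D(u)}-k^2\right)\Phi(u)$ and $c=-kD(0)$, and consider $u_t=(D(u)u_x)_x+R(u)$. Let $$u_l=\frac{a+b-\sqrt{3(a-b)^2}}2,\qquad u_r=\frac{a+b+\sqrt{3(a-b)^2}}2,$$ which is the unique pair $u_l<u_r$ with $\Phi(u_l)=\Phi(u_r)$ and $\Phi'(u_l)=\Phi'(u_r)$; under the above assumptions $0<u_l<a<b<u_r<1$. In the coordinate $z=x-ct$, let $\bar u$ be the receding shock-fronted travelling wave on $(-\infty,0)$ given by $\Phi(\bar u(z))=\Phi(0)e^{kz}$, with $\bar u(z)\in(u_r,1)$ for $z<z_s$ and $\bar u(z)\in(0,u_l)$ for $z_s<z<0$, where the shock position $z_s<0$ is given by $\Phi(u_l)=\Phi(0)e^{kz_s}$. Let $\mathcal L(\bar u)$ be the linearised operator $$\mathcal L(\bar u)p=(D(\bar u)p)_{zz}+c\,p_z+R'(\bar u)p$$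 in $L^2((-\infty,0);\mathbb C)$, where the derivatives are taken on each side of the shock and the domain consists of all $p$ that are $H^2$ on $(-\infty,z_s)$ and on $(z_s,0)$, are $C^1$ across $z_s$, and satisfy $p(0)=0$ and $\lim_{z\to-\infty}p(z)=0$. Its spectrum $\sigma(\mathcal L(\bar u))$ is the set of $\lambda\in\mathbb C$ for which $\mathcal L(\bar u)-\lambda$ does not have a bounded inverse on $L^2((-\infty,0);\mathbb C)$. Suppose that $$\tfrac12 D(\bar u)_{zz}+R'(\bar u)<0\quad\text{for all values } \bar u=u\in[0,u_l]\cup[u_r,1],$$ where $D(\bar u)_{zz}$ is regarded as a function of the value $u$ of $\bar u$ through $\bar u_z=k\Phi(\bar u)/D(\bar u)$, that is, $D(\bar u)_{zz}=\frac{d}{du}\!\left(D'(u)\frac{k\Phi(u)}{D(u)}\right)\frac{k\Phi(u)}{D(u)}$. Then $\bar u$ is spectrally stable: every $\lambda\in\sigma(\mathcal L(\bar u))$ satisfies $\operatorname{Re}\lambda<0$. -/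

import Mathlib

open MeasureTheory Set Filter Topology

namespace RecedingWave

noncomputable section

/-! ### The model -/

/-- The quadratic diffusivity `D(u) = (u - a)(u - b)`. -/
def diffusivity (a b u : ℝ) : ℝ := (u - a) * (u - b)

/-- The Kirchhoff variable `Φ(u) = ∫_1^u D`, normalised by `Φ(1) = 0`. -/
def kirchhoff (a b u : ℝ) : ℝ := ∫ v in (1 : ℝ)..u, diffusivity a b v

/-- The reaction term `R(u) = (A / D(u) + κ) Φ(u)` with `κ = -k²` and `A = -κ D(0) = k² D(0)`. -/
def reaction (a b k u : ℝ) : ℝ :=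
  (k ^ 2 * diffusivity a b 0 / diffusivity a b u + -k ^ 2) * kirchhoff a b u

/-- The speed `c = -A / k = -k D(0)` of the wave, `z = x - c t`. -/
def speed (a b k : ℝ) : ℝ := -k * diffusivity a b 0

/-- The lower end `u_l` of the shock. -/
def shockLower (a b : ℝ) : ℝ := (a + b - √(3 * (a - b) ^ 2)) / 2

/-- The upper end `u_r` of the shock. -/
def shockUpper (a b : ℝ) : ℝ := (a + b + √(3 * (a - b) ^ 2)) / 2

/-- The position `z_s` of the shock: `Φ(u_l) = Φ(0) exp (k z_s)`. -/
def shockPos (a b k : ℝ) : ℝ :=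
  Real.log (kirchhoff a b (shockLower a b) / kirchhoff a b 0) / k

/-- The shock-fronted wave `ū`: the solution of `Φ(ū(z)) = c₁ exp (k z)`, `c₁ = Φ(0)` (so that the
front `ū = 0` is at `z = 0`), on the branch `[u_r, 1]` to the left of the shock and on the branch
`[0, u_l]` to the right of it. Only `z < 0` matters. See `wave_left`, `wave_right`. -/
def wave (a b k z : ℝ) : ℝ :=
  if z < shockPos a b k then
    Function.invFunOn (kirchhoff a b) (Icc (shockUpper a b) 1) (kirchhoff a b 0 * Real.exp (k * z))
  else
    Function.invFunOn (kirchhoff a b) (Icc 0 (shockLower a b)) (kirchhoff a b 0 * Real.exp (k * z))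

/-- The slope `ū_z = k Φ(ū) / D(ū)` of the wave as a function of the value `u` of `ū`
(differentiate `Φ(ū) = c₁ exp (k z)`). See `hasDerivAt_wave`. -/
def waveSlope (a b k u : ℝ) : ℝ := k * kirchhoff a b u / diffusivity a b u

/-- `D(ū)_zz` as a function of the value `u` of `ū`: `D(ū)_z = D'(ū) ū_z`, and one more `z`
derivative by the chain rule. See `deriv_deriv_diffusivity_wave`. At the value `u = 1`, which `ū`
only approaches as `z → -∞`, this is the limit. -/
def diffusivityZZ (a b k u : ℝ) : ℝ :=
  deriv (fun w => deriv (diffusivity a b) w * waveSlope a b k w) u * waveSlope a b k u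

/-! ### The linearised operator -/

/-- The Hilbert space `L²((-∞, 0); ℂ)`. -/
abbrev L2Neg : Type := Lp ℂ 2 (volume.restrict (Iio (0 : ℝ)))

/-- On the interval `I`, `F` is locally absolutely continuous with almost everywhere (equivalently,
weak) derivative `G`. -/
def HasACDerivOn (F G : ℝ → ℂ) (I : Set ℝ) : Prop :=
  ∀ x ∈ I, ∀ y ∈ I, IntervalIntegrable G volume x y ∧ F y - F x = ∫ t in x..y, G t

/-- `P` is an admissible perturbation, for a shock at `s`, with derivatives `P₁` and `P₂`: it is
`H²` on `(-∞, s)` and on `(s, 0)`, it is `C¹` on `(-∞, 0)`, in particular across the shock, and it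
vanishes at `0` and at `-∞`. -/
structure IsAdmissible (s : ℝ) (P P₁ P₂ : ℝ → ℂ) : Prop where
  hasDerivAt : ∀ z < 0, HasDerivAt P (P₁ z) z
  continuousOn : ContinuousOn P₁ (Iio 0)
  left : HasACDerivOn P₁ P₂ (Iio s)
  right : HasACDerivOn P₁ P₂ (Ioo s 0)
  memLp : MemLp P 2 (volume.restrict (Iio 0))
  memLp_one : MemLp P₁ 2 (volume.restrict (Iio 0))
  memLp_two : MemLp P₂ 2 (volume.restrict (Iio 0))
  front : Tendsto P (𝓝[<] 0) (𝓝 0)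
  farField : Tendsto P atBot (𝓝 0)

/-- `f = (D(ū) p)_zz + c p_z + R'(ū) p` on `(-∞, 0)`, for an admissible `p`. The second derivative
`Q₁` of `D(ū) p` is taken on each side of the shock. -/
def IsLinearisation (a b k : ℝ) (p f : L2Neg) : Prop :=
  ∃ P P₁ P₂ Q Q₁ : ℝ → ℂ,
    IsAdmissible (shockPos a b k) P P₁ P₂ ∧
    p =ᵐ[volume.restrict (Iio 0)] P ∧
    (∀ z < 0, z ≠ shockPos a b k →
      HasDerivAt (fun y => (diffusivity a b (wave a b k y) : ℂ) * P y) (Q z) z) ∧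
    HasACDerivOn Q Q₁ (Iio (shockPos a b k)) ∧
    HasACDerivOn Q Q₁ (Ioo (shockPos a b k) 0) ∧
    f =ᵐ[volume.restrict (Iio 0)] fun z =>
      Q₁ z + (speed a b k : ℂ) * P₁ z + ((deriv (reaction a b k) (wave a b k z) : ℝ) : ℂ) * P z

theorem HasACDerivOn.add {F G F' G' : ℝ → ℂ} {I : Set ℝ} (h : HasACDerivOn F G I)
    (h' : HasACDerivOn F' G' I) : HasACDerivOn (F + F') (G + G') I := by
  intro x hx y hy
  obtain ⟨h1, h2⟩ := h x hx y hy
  obtain ⟨h3, h4⟩ := h' x hx y hy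
  refine ⟨h1.add h3, ?_⟩
  simp only [Pi.add_apply]
  rw [intervalIntegral.integral_add h1 h3, ← h2, ← h4]
  ring

theorem HasACDerivOn.smul {F G : ℝ → ℂ} {I : Set ℝ} (c : ℂ) (h : HasACDerivOn F G I) :
    HasACDerivOn (c • F) (c • G) I := by
  intro x hx y hy
  obtain ⟨h1, h2⟩ := h x hx y hy
  refine ⟨h1.smul c, ?_⟩
  simp only [Pi.smul_apply]
  rw [intervalIntegral.integral_smul, ← h2, smul_sub]

theorem IsLinearisation.add {a b k : ℝ} {p f p' f' : L2Neg} (h : IsLinearisation a b k p f)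
    (h' : IsLinearisation a b k p' f') : IsLinearisation a b k (p + p') (f + f') := by
  obtain ⟨P, P₁, P₂, Q, Q₁, hP, hp, hQ, hl, hr, hf⟩ := h
  obtain ⟨P', P₁', P₂', Q', Q₁', hP', hp', hQ', hl', hr', hf'⟩ := h'
  refine ⟨P + P', P₁ + P₁', P₂ + P₂', Q + Q', Q₁ + Q₁',
    ⟨fun z hz => (hP.hasDerivAt z hz).add (hP'.hasDerivAt z hz),
      hP.continuousOn.add hP'.continuousOn, hP.left.add hP'.left, hP.right.add hP'.right,
      hP.memLp.add hP'.memLp, hP.memLp_one.add hP'.memLp_one, hP.memLp_two.add hP'.memLp_two,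
      (add_zero (0 : ℂ)) ▸ hP.front.add hP'.front,
      (add_zero (0 : ℂ)) ▸ hP.farField.add hP'.farField⟩,
    ?_, ?_, hl.add hl', hr.add hr', ?_⟩
  · filter_upwards [hp, hp', Lp.coeFn_add p p'] with z h1 h2 h3
    rw [h3, Pi.add_apply, h1, h2, Pi.add_apply]
  · intro z hz hzs
    convert! (hQ z hz hzs).add (hQ' z hz hzs) using 1
    funext y
    simp [mul_add]
  · filter_upwards [hf, hf', Lp.coeFn_add f f'] with z h1 h2 h3
    rw [h3, Pi.add_apply, h1, h2]
    simp only [Pi.add_apply]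
    ring

theorem IsLinearisation.smul {a b k : ℝ} {p f : L2Neg} (c : ℂ) (h : IsLinearisation a b k p f) :
    IsLinearisation a b k (c • p) (c • f) := by
  obtain ⟨P, P₁, P₂, Q, Q₁, hP, hp, hQ, hl, hr, hf⟩ := h
  refine ⟨c • P, c • P₁, c • P₂, c • Q, c • Q₁,
    ⟨fun z hz => (hP.hasDerivAt z hz).const_smul c,
      hP.continuousOn.const_smul c, hP.left.smul c, hP.right.smul c,
      hP.memLp.const_smul c, hP.memLp_one.const_smul c, hP.memLp_two.const_smul c,
      (smul_zero c : c • (0 : ℂ) = 0) ▸ hP.front.const_smul c,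
      (smul_zero c : c • (0 : ℂ) = 0) ▸ hP.farField.const_smul c⟩,
    ?_, ?_, hl.smul c, hr.smul c, ?_⟩
  · filter_upwards [hp, Lp.coeFn_smul c p] with z h1 h3
    rw [h3, Pi.smul_apply, h1, Pi.smul_apply]
  · intro z hz hzs
    convert! (hQ z hz hzs).const_smul c using 1
    funext y
    simp [mul_left_comm]
  · filter_upwards [hf, Lp.coeFn_smul c f] with z h1 h3
    rw [h3, Pi.smul_apply, h1]
    simp only [Pi.smul_apply, smul_eq_mul]
    ring

theorem IsLinearisation.zero (a b k : ℝ) : IsLinearisation a b k 0 0 := by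
  have hz' : ∀ I, HasACDerivOn (0 : ℝ → ℂ) 0 I := fun I x _ y _ =>
    ⟨intervalIntegrable_const (c := (0 : ℂ)), by simp⟩
  refine ⟨0, 0, 0, 0, 0, ⟨fun z _ => hasDerivAt_const z 0, continuousOn_const, hz' _, hz' _,
    MemLp.zero, MemLp.zero, MemLp.zero, tendsto_const_nhds, tendsto_const_nhds⟩,
    Lp.coeFn_zero _ _ _, ?_, hz' _, hz' _, ?_⟩
  · intro z _ _
    simpa using hasDerivAt_const z (0 : ℂ)
  · filter_upwards [Lp.coeFn_zero ℂ 2 (volume.restrict (Iio (0 : ℝ)))] with z h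
    simpa using h

/-- The graph of the linearised operator. -/
def linearisedGraph (a b k : ℝ) : Submodule ℂ (L2Neg × L2Neg) where
  carrier := {x | IsLinearisation a b k x.1 x.2}
  add_mem' := fun h h' => h.add h'
  zero_mem' := IsLinearisation.zero a b k
  smul_mem' := fun c _ h => h.smul c

/-- The linearised operator `𝓛(ū) p = (D(ū) p)_zz + c p_z + R'(ū) p` in `L²((-∞, 0))`, an unbounded
operator whose domain is the set of admissible perturbations. See `mem_graph_linearisedOperator`. -/
def linearisedOperator (a b k : ℝ) : L2Neg →ₗ.[ℂ] L2Neg := (linearisedGraph a b k).toLinearPMap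

/-! ### Spectral stability -/

/-- The spectrum of an unbounded operator `T`: the `μ` for which `T - μ` has no bounded inverse. -/
def spectrumOp {E : Type*} [NormedAddCommGroup E] [NormedSpace ℂ E] (T : E →ₗ.[ℂ] E) : Set ℂ :=
  {μ | ¬ ∃ B : E →L[ℂ] E,
    (∀ f : E, ∃ h : B f ∈ T.domain, T ⟨B f, h⟩ - μ • B f = f) ∧
    ∀ p : T.domain, B (T p - μ • (p : E)) = p}

/-- Spectral stability: the spectrum lies in the open left half plane. -/
def SpectrallyStable {E : Type*} [NormedAddCommGroup E] [NormedSpace ℂ E]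
    (T : E →ₗ.[ℂ] E) : Prop :=
  ∀ μ ∈ spectrumOp T, μ.re < 0

/-! ### The definitions mean what they should -/

theorem HasACDerivOn.ae_eq_zero {F G : ℝ → ℂ} {I : Set ℝ} (hI : IsOpen I)
    (h : HasACDerivOn F G I) (hF : ∀ x ∈ I, F x = 0) : ∀ᵐ x, x ∈ I → G x = 0 := by
  have key : ∀ᵐ x, ∀ q r : ℚ, (q : ℝ) ∈ I → (r : ℝ) ∈ I → x ∈ uIcc (q : ℝ) r →
      ∀ c ∈ uIcc (q : ℝ) r, HasDerivAt (fun x => ∫ t in c..x, G t) (G x) x := by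
    rw [ae_all_iff]; intro q
    rw [ae_all_iff]; intro r
    by_cases hq : (q : ℝ) ∈ I
    · by_cases hr : (r : ℝ) ∈ I
      · filter_upwards [(h q hq r hr).1.ae_hasDerivAt_integral] with x hx _ _ using hx
      · exact Eventually.of_forall fun x _ hr' => absurd hr' hr
    · exact Eventually.of_forall fun x hq' => absurd hq' hq
  filter_upwards [key] with x hx hxI
  obtain ⟨ε, hε, hball⟩ := Metric.isOpen_iff.1 hI x hxI
  rw [Real.ball_eq_Ioo] at hball
  obtain ⟨q, hq1, hq2⟩ := exists_rat_btwn (show x - ε < x by linarith)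
  obtain ⟨r, hr1, hr2⟩ := exists_rat_btwn (show x < x + ε by linarith)
  have hq : (q : ℝ) ∈ I := hball ⟨hq1, by linarith⟩
  have hr : (r : ℝ) ∈ I := hball ⟨by linarith, hr2⟩
  have hu : uIcc (q : ℝ) r = Icc (q : ℝ) r := uIcc_of_le (by linarith)
  have hd := hx q r hq hr (by rw [hu]; exact ⟨hq2.le, hr1.le⟩) q (by simp)
  have hev : (fun x => ∫ t in (q : ℝ)..x, G t) =ᶠ[𝓝 x] fun _ => 0 := by
    filter_upwards [hI.mem_nhds hxI] with y hy
    rw [← (h q hq y hy).2, hF y hy, hF q hq, sub_zero]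
  exact hd.unique ((hasDerivAt_const x (0 : ℂ)).congr_of_eventuallyEq hev)

theorem linearisedGraph_functional (a b k : ℝ) (x : L2Neg × L2Neg)
    (hx : x ∈ linearisedGraph a b k) (hx0 : x.1 = 0) : x.2 = 0 := by
  obtain ⟨p, f⟩ := x
  obtain ⟨P, P₁, P₂, Q, Q₁, hP, hp, hQ, hl, hr, hf⟩ := hx
  simp only at hx0 hp hf ⊢
  subst hx0
  set s := shockPos a b k
  have hP0 : EqOn P 0 (Iio 0) := by
    refine Measure.eqOn_open_of_ae_eq (μ := volume) ?_ isOpen_Iio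
      (fun z hz => (hP.hasDerivAt z hz).continuousAt.continuousWithinAt) continuousOn_const
    filter_upwards [hp, Lp.coeFn_zero ℂ 2 (volume.restrict (Iio (0 : ℝ)))] with z h1 h2
    rw [← h1, h2]
  have hP1 : ∀ z < 0, P₁ z = 0 := fun z hz =>
    (hP.hasDerivAt z hz).unique ((hasDerivAt_const z (0 : ℂ)).congr_of_eventuallyEq
      (by filter_upwards [isOpen_Iio.mem_nhds hz] with y hy using hP0 hy))
  have hQ0 : ∀ z < 0, z ≠ s → Q z = 0 := fun z hz hzs =>
    (hQ z hz hzs).unique ((hasDerivAt_const z (0 : ℂ)).congr_of_eventuallyEq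
      (by filter_upwards [isOpen_Iio.mem_nhds hz] with y hy; simp [hP0 hy]))
  have hl' : HasACDerivOn Q Q₁ (Iio (min s 0)) := fun x hx y hy =>
    hl x (Iio_subset_Iio (min_le_left _ _) hx) y (Iio_subset_Iio (min_le_left _ _) hy)
  have h1 := hl'.ae_eq_zero isOpen_Iio fun z hz =>
    hQ0 z (lt_of_lt_of_le hz (min_le_right _ _)) (lt_of_lt_of_le hz (min_le_left _ _)).ne
  have h2 := hr.ae_eq_zero isOpen_Ioo fun z hz => hQ0 z hz.2 hz.1.ne'
  have h3 : ∀ᵐ z : ℝ, z ≠ s := by simp [ae_iff, measure_singleton]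
  rw [Lp.eq_zero_iff_ae_eq_zero]
  filter_upwards [hf, ae_restrict_of_ae h1, ae_restrict_of_ae h2, ae_restrict_of_ae h3,
    ae_restrict_mem measurableSet_Iio] with z e e1 e2 e3 hz
  have hz' : z < 0 := hz
  have : Q₁ z = 0 := by
    rcases lt_or_gt_of_ne e3 with h | h
    · exact e1 (lt_min h hz')
    · exact e2 ⟨h, hz'⟩
  rw [e, this, hP1 z hz', hP0 hz]
  simp

/-- `𝓛(ū) p = f` means exactly that `p` is admissible and `f = (D(ū) p)_zz + c p_z + R'(ū) p`. -/
theorem mem_graph_linearisedOperator (a b k : ℝ) (p f : L2Neg) :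
    (p, f) ∈ (linearisedOperator a b k).graph ↔ IsLinearisation a b k p f := by
  rw [linearisedOperator, Submodule.toLinearPMap_graph_eq _ (linearisedGraph_functional a b k)]
  rfl

theorem hasDerivAt_diffusivity (a b u : ℝ) :
    HasDerivAt (diffusivity a b) (2 * u - a - b) u := by
  have := ((hasDerivAt_id u).sub_const a).mul ((hasDerivAt_id u).sub_const b)
  convert! this using 1
  simp; ring

theorem continuous_diffusivity (a b : ℝ) : Continuous (diffusivity a b) := by
  unfold diffusivity; fun_prop

theorem hasDerivAt_kirchhoff (a b u : ℝ) :
    HasDerivAt (kirchhoff a b) (diffusivity a b u) u :=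
  intervalIntegral.integral_hasDerivAt_right
    ((continuous_diffusivity a b).intervalIntegrable _ _)
    ((continuous_diffusivity a b).stronglyMeasurableAtFilter _ _)
    (continuous_diffusivity a b).continuousAt

theorem kirchhoff_eq (a b u : ℝ) : kirchhoff a b u =
    1 / 6 * (u - 1) * (2 * u ^ 2 + (2 - 3 * a - 3 * b) * u + 2 - 3 * a - 3 * b + 6 * a * b) := by
  have h : ∀ x ∈ uIcc 1 u, HasDerivAt (fun u : ℝ => 1 / 6 * (u - 1) *
      (2 * u ^ 2 + (2 - 3 * a - 3 * b) * u + 2 - 3 * a - 3 * b + 6 * a * b))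
      (diffusivity a b x) x := by
    intro x _
    have h1 : HasDerivAt (fun u : ℝ => 1 / 6 * (u - 1)) (1 / 6) x := by
      simpa using ((hasDerivAt_id x).sub_const 1).const_mul (1 / 6 : ℝ)
    have h2 : HasDerivAt (fun u : ℝ => 2 * u ^ 2 + (2 - 3 * a - 3 * b) * u + 2 - 3 * a - 3 * b +
        6 * a * b) (4 * x + (2 - 3 * a - 3 * b)) x := by
      have h3 := ((((((hasDerivAt_pow 2 x).const_mul 2).add ((hasDerivAt_id x).const_mul
        (2 - 3 * a - 3 * b))).add_const 2).sub_const (3 * a)).sub_const (3 * b)).add_const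
        (6 * a * b)
      convert! h3 using 1
      norm_num; ring
    convert! h1.mul h2 using 1
    simp only [diffusivity]
    ring
  rw [kirchhoff, intervalIntegral.integral_eq_sub_of_hasDerivAt h
    ((continuous_diffusivity a b).intervalIntegrable _ _)]
  ring

/-- The shock is the one that is fixed by continuity of `Φ` and of `Φ' = D`. -/
theorem shock_iff {a b : ℝ} (hab : a < b) (l r : ℝ) :
    (l < r ∧ kirchhoff a b l = kirchhoff a b r ∧ diffusivity a b l = diffusivity a b r) ↔
      l = shockLower a b ∧ r = shockUpper a b := by
  have hs : √(3 * (a - b) ^ 2) ^ 2 = 3 * (a - b) ^ 2 := Real.sq_sqrt (by positivity)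
  have hs0 : 0 < √(3 * (a - b) ^ 2) := Real.sqrt_pos.2 (by have := sq_pos_of_neg (sub_neg.2 hab); positivity)
  simp only [kirchhoff_eq, diffusivity, shockLower, shockUpper]
  set s := √(3 * (a - b) ^ 2)
  constructor
  · rintro ⟨hlr, h1, h2⟩
    have hne : l - r ≠ 0 := (sub_neg.2 hlr).ne
    have hr : l + r = a + b := by
      apply mul_left_cancel₀ hne
      linear_combination h2
    have hl : r = a + b - l := by linarith
    have h3 : (r - l) ^ 2 = s ^ 2 := by
      apply mul_left_cancel₀ hne
      rw [hs]
      subst hl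
      linear_combination 12 * h1
    have h4 : r - l = s := by
      rcases sq_eq_sq_iff_eq_or_eq_neg.1 h3 with h | h <;> linarith
    constructor <;> linarith
  · rintro ⟨rfl, rfl⟩
    refine ⟨by linarith, ?_, by ring⟩
    linear_combination (-s / 12) * hs

theorem sqrt_shock {a b : ℝ} (hab : a < b) : √(3 * (a - b) ^ 2) = √3 * (b - a) := by
  rw [Real.sqrt_mul (by norm_num), Real.sqrt_sq_eq_abs, abs_of_neg (by linarith), neg_sub]

theorem strictMonoOn_kirchhoff_right {a b : ℝ} (hab : a < b) :
    StrictMonoOn (kirchhoff a b) (Ici b) := by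
  refine strictMonoOn_of_deriv_pos (convex_Ici b)
    (fun u _ => (hasDerivAt_kirchhoff a b u).continuousAt.continuousWithinAt) fun u hu => ?_
  rw [interior_Ici] at hu
  rw [(hasDerivAt_kirchhoff a b u).deriv]
  exact mul_pos (sub_pos.2 (hab.trans hu)) (sub_pos.2 hu)

theorem strictMonoOn_kirchhoff_left {a b : ℝ} (hab : a < b) :
    StrictMonoOn (kirchhoff a b) (Iic a) := by
  refine strictMonoOn_of_deriv_pos (convex_Iic a)
    (fun u _ => (hasDerivAt_kirchhoff a b u).continuousAt.continuousWithinAt) fun u hu => ?_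
  rw [interior_Iic] at hu
  rw [(hasDerivAt_kirchhoff a b u).deriv]
  exact mul_pos_of_neg_of_neg (sub_neg.2 hu) (sub_neg.2 (lt_trans hu hab))

theorem shock_bounds {a b : ℝ} (hab : a < b) (hneg : b < (a + 2) / 3) (hpos : b < a * (2 + √3)) :
    0 < shockLower a b ∧ shockLower a b < a ∧ b < shockUpper a b ∧ shockUpper a b < 1 ∧
      kirchhoff a b 0 < kirchhoff a b (shockLower a b) ∧
      kirchhoff a b (shockLower a b) < 0 := by
  have ht : √3 ^ 2 = 3 := Real.sq_sqrt (by norm_num)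
  have ht1 : 1 < √3 := Real.lt_sqrt_of_sq_lt (by norm_num)
  have h0 : 0 < shockLower a b := by
    rw [shockLower, sqrt_shock hab]
    nlinarith [mul_pos (sub_pos.2 ht1) (sub_pos.2 hpos)]
  have hl : shockLower a b < a := by
    rw [shockLower, sqrt_shock hab]
    nlinarith [mul_pos (sub_pos.2 ht1) (sub_pos.2 hab)]
  have hr : b < shockUpper a b := by
    rw [shockUpper, sqrt_shock hab]
    nlinarith [mul_pos (sub_pos.2 ht1) (sub_pos.2 hab)]
  have hm := strictMonoOn_kirchhoff_left hab
  have h1 : kirchhoff a b 0 < kirchhoff a b (shockLower a b) :=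
    hm (by simp only [mem_Iic]; linarith) hl.le h0
  have h2 : kirchhoff a b (shockLower a b) < kirchhoff a b a := hm hl.le (mem_Iic.2 le_rfl) hl
  have h3 : kirchhoff a b a < 0 := by
    have : kirchhoff a b a = -(1 / 6 * ((1 - a) ^ 2 * (a + 2 - 3 * b))) := by
      rw [kirchhoff_eq]; ring
    rw [this]
    have : 0 < (1 - a) ^ 2 * (a + 2 - 3 * b) := mul_pos (pow_pos (by linarith) 2) (by linarith)
    linarith
  refine ⟨h0, hl, hr, ?_, h1, h2.trans h3⟩
  by_contra! h
  have h4 := (strictMonoOn_kirchhoff_right hab).monotoneOn (mem_Ici.2 (by linarith)) hr.le h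
  have h5 := ((shock_iff hab _ _).2 ⟨rfl, rfl⟩).2.1
  have h6 : kirchhoff a b 1 = 0 := by simp [kirchhoff]
  linarith

/-- `Φ(u_l) = c₁ exp (k z_s)`, and the shock is behind the front. -/
theorem shockPos_spec {a b k : ℝ} (hab : a < b) (hneg : b < (a + 2) / 3)
    (hpos : b < a * (2 + √3)) (hk : 0 < k) :
    shockPos a b k < 0 ∧
      kirchhoff a b 0 * Real.exp (k * shockPos a b k) = kirchhoff a b (shockLower a b) := by
  obtain ⟨-, -, -, -, h1, h2⟩ := shock_bounds hab hneg hpos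
  have h3 : kirchhoff a b 0 < 0 := h1.trans h2
  constructor
  · exact div_neg_of_neg_of_pos (Real.log_neg (div_pos_of_neg_of_neg h2 h3)
      ((div_lt_one_of_neg h3).2 h1)) hk
  · rw [shockPos, mul_div_cancel₀ _ hk.ne', Real.exp_log (div_pos_of_neg_of_neg h2 h3),
      mul_div_cancel₀ _ h3.ne]

/-- To the left of the shock, `ū` is the solution with values in `(u_r, 1)`. -/
theorem wave_left {a b k z : ℝ} (hab : a < b) (hneg : b < (a + 2) / 3)
    (hpos : b < a * (2 + √3)) (hk : 0 < k) (hz : z < shockPos a b k) :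
    wave a b k z ∈ Ioo (shockUpper a b) 1 ∧
      kirchhoff a b (wave a b k z) = kirchhoff a b 0 * Real.exp (k * z) := by
  obtain ⟨h0, hl, hr, hr1, h1, h2⟩ := shock_bounds hab hneg hpos
  obtain ⟨hs, hs'⟩ := shockPos_spec hab hneg hpos hk
  have h3 : kirchhoff a b 0 < 0 := h1.trans h2
  have h5 := ((shock_iff hab _ _).2 ⟨rfl, rfl⟩).2.1
  have h6 : kirchhoff a b 1 = 0 := by simp [kirchhoff]
  have hmem : kirchhoff a b 0 * Real.exp (k * z) ∈
      Icc (kirchhoff a b (shockUpper a b)) (kirchhoff a b 1) := by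
    rw [h6, ← h5, ← hs']
    refine ⟨mul_le_mul_of_nonpos_left (Real.exp_le_exp.2 ?_) h3.le,
      mul_nonpos_of_nonpos_of_nonneg h3.le (Real.exp_pos _).le⟩
    exact mul_le_mul_of_nonneg_left hz.le hk.le
  have hex := intermediate_value_Icc hr1.le
    (fun u _ => (hasDerivAt_kirchhoff a b u).continuousAt.continuousWithinAt) hmem
  rw [wave, if_pos hz]
  obtain ⟨hm, he⟩ := Function.invFunOn_pos hex
  refine ⟨⟨lt_of_le_of_ne hm.1 fun h => ?_, lt_of_le_of_ne hm.2 fun h => ?_⟩, he⟩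
  · rw [← h, ← h5, ← hs'] at he
    have := Real.exp_injective (mul_left_cancel₀ h3.ne he)
    exact hz.ne' (mul_left_cancel₀ hk.ne' this)
  · rw [h, h6] at he
    exact (mul_neg_of_neg_of_pos h3 (Real.exp_pos (k * z))).ne he.symm

/-- Between the shock and the front, `ū` is the solution with values in `[0, u_l]`. -/
theorem wave_right {a b k z : ℝ} (hab : a < b) (hneg : b < (a + 2) / 3)
    (hpos : b < a * (2 + √3)) (hk : 0 < k) (hz : shockPos a b k < z) (hz0 : z < 0) :
    wave a b k z ∈ Ioo 0 (shockLower a b) ∧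
      kirchhoff a b (wave a b k z) = kirchhoff a b 0 * Real.exp (k * z) := by
  obtain ⟨h0, hl, hr, hr1, h1, h2⟩ := shock_bounds hab hneg hpos
  obtain ⟨hs, hs'⟩ := shockPos_spec hab hneg hpos hk
  have h3 : kirchhoff a b 0 < 0 := h1.trans h2
  have hmem : kirchhoff a b 0 * Real.exp (k * z) ∈
      Icc (kirchhoff a b 0) (kirchhoff a b (shockLower a b)) := by
    rw [← hs']
    constructor
    · nlinarith [Real.exp_le_one_iff.2 (mul_nonpos_of_nonneg_of_nonpos hk.le hz0.le)]
    · exact mul_le_mul_of_nonpos_left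
        (Real.exp_le_exp.2 (mul_le_mul_of_nonneg_left hz.le hk.le)) h3.le
  have hex := intermediate_value_Icc h0.le
    (fun u _ => (hasDerivAt_kirchhoff a b u).continuousAt.continuousWithinAt) hmem
  rw [wave, if_neg hz.not_gt]
  obtain ⟨hm, he⟩ := Function.invFunOn_pos hex
  refine ⟨⟨lt_of_le_of_ne hm.1 fun h => ?_, lt_of_le_of_ne hm.2 fun h => ?_⟩, he⟩
  · rw [← h] at he
    have h7 : Real.exp (k * z) = 1 := mul_left_cancel₀ h3.ne (by linarith)
    rw [Real.exp_eq_one_iff] at h7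
    exact (mul_neg_of_pos_of_neg hk hz0).ne h7
  · rw [h, ← hs'] at he
    have := Real.exp_injective (mul_left_cancel₀ h3.ne he)
    exact hz.ne (mul_left_cancel₀ hk.ne' this)

theorem hasDerivAt_wave {a b k z : ℝ} (hab : a < b) (hneg : b < (a + 2) / 3)
    (hpos : b < a * (2 + √3)) (hk : 0 < k) (hz0 : z < 0) (hzs : z ≠ shockPos a b k) :
    HasDerivAt (wave a b k) (waveSlope a b k (wave a b k z)) z ∧
      0 < diffusivity a b (wave a b k z) := by
  obtain ⟨h0, hl, hr, hr1, h1, h2⟩ := shock_bounds hab hneg hpos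
  -- the branch that contains the value of the wave
  obtain ⟨I, hIo, hz, hinj, hev⟩ : ∃ I : Set ℝ, IsOpen I ∧ wave a b k z ∈ I ∧
      (∀ u ∈ I, ∀ v ∈ I, kirchhoff a b u = kirchhoff a b v → u = v) ∧
      (∀ᶠ y in 𝓝 z, wave a b k y ∈ I ∧
        kirchhoff a b (wave a b k y) = kirchhoff a b 0 * Real.exp (k * y)) ∧
      ∀ u ∈ I, 0 < diffusivity a b u := by
    rcases lt_or_gt_of_ne hzs with h | h
    · refine ⟨Ioo (shockUpper a b) 1, isOpen_Ioo, (wave_left hab hneg hpos hk h).1, ?_, ?_, ?_⟩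
      · intro u hu v hv
        exact (strictMonoOn_kirchhoff_right hab).injOn (hr.trans hu.1).le (hr.trans hv.1).le
      · filter_upwards [isOpen_Iio.mem_nhds h] with y hy using wave_left hab hneg hpos hk hy
      · intro u hu
        exact mul_pos (by linarith [hu.1]) (by linarith [hu.1])
    · refine ⟨Ioo 0 (shockLower a b), isOpen_Ioo, (wave_right hab hneg hpos hk h hz0).1, ?_, ?_, ?_⟩
      · intro u hu v hv
        exact (strictMonoOn_kirchhoff_left hab).injOn (hu.2.trans hl).le (hv.2.trans hl).le
      · filter_upwards [isOpen_Ioo.mem_nhds (show z ∈ Ioo (shockPos a b k) 0 from ⟨h, hz0⟩)] with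
          y hy using wave_right hab hneg hpos hk hy.1 hy.2
      · intro u hu
        exact mul_pos_of_neg_of_neg (by linarith [hu.2]) (by linarith [hu.2])
  obtain ⟨hev, hD⟩ := hev
  have hDz := hD _ hz
  refine ⟨?_, hDz⟩
  have hΦz := hev.self_of_nhds.2
  have hcd : ContDiff ℝ 1 (kirchhoff a b) := by
    have : kirchhoff a b = fun u => 1 / 6 * (u - 1) *
        (2 * u ^ 2 + (2 - 3 * a - 3 * b) * u + 2 - 3 * a - 3 * b + 6 * a * b) :=
      funext (kirchhoff_eq a b)
    rw [this]; fun_prop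
  have hst : HasStrictDerivAt (kirchhoff a b) (diffusivity a b (wave a b k z)) (wave a b k z) :=
    hcd.contDiffAt.hasStrictDerivAt' (hasDerivAt_kirchhoff a b _) (by norm_num)
  have hg := hst.to_localInverse hDz.ne'
  set g := hst.localInverse _ _ _ hDz.ne' with hgdef
  have hgz : g (kirchhoff a b (wave a b k z)) = wave a b k z :=
    (hst.hasStrictFDerivAt_equiv hDz.ne').localInverse_apply_image
  have hgr : ∀ᶠ y in 𝓝 (kirchhoff a b (wave a b k z)), kirchhoff a b (g y) = y :=
    (hst.hasStrictFDerivAt_equiv hDz.ne').eventually_right_inverse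
  have hgI : ∀ᶠ y in 𝓝 (kirchhoff a b (wave a b k z)), g y ∈ I :=
    hg.hasDerivAt.continuousAt.eventually (by rw [hgz]; exact hIo.mem_nhds hz)
  have hexp : HasDerivAt (fun y => kirchhoff a b 0 * Real.exp (k * y))
      (k * kirchhoff a b (wave a b k z)) z := by
    have := (((hasDerivAt_id z).const_mul k).exp).const_mul (kirchhoff a b 0)
    convert! this using 1
    rw [hΦz]; simp; ring
  have hcont := hexp.continuousAt.tendsto
  simp only [← hΦz] at hcont
  have hcomp := HasDerivAt.comp z (h₂ := g) (by rw [← hΦz]; exact hg.hasDerivAt) hexp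
  have heq : wave a b k =ᶠ[𝓝 z] g ∘ fun y => kirchhoff a b 0 * Real.exp (k * y) := by
    filter_upwards [hev, hcont.eventually hgr, hcont.eventually hgI] with y e1 e2 e3
    exact hinj _ e1.1 _ e3 (by rw [e1.2]; exact e2.symm)
  refine (hcomp.congr_of_eventuallyEq heq).congr_deriv ?_
  rw [waveSlope]; field_simp

/-- The `z` derivative of `D(ū)` of order two is `diffusivityZZ` at the value of `ū`. -/
theorem deriv_deriv_diffusivity_wave {a b k z : ℝ} (hab : a < b) (hneg : b < (a + 2) / 3)
    (hpos : b < a * (2 + √3)) (hk : 0 < k) (hz0 : z < 0) (hzs : z ≠ shockPos a b k) :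
    deriv (deriv fun y => diffusivity a b (wave a b k y)) z =
      diffusivityZZ a b k (wave a b k z) := by
  have h1 : ∀ᶠ y in 𝓝 z, deriv (fun y => diffusivity a b (wave a b k y)) y =
      deriv (diffusivity a b) (wave a b k y) * waveSlope a b k (wave a b k y) := by
    filter_upwards [isOpen_Iio.mem_nhds hz0, isOpen_ne.mem_nhds hzs] with y hy hys
    have hw := (hasDerivAt_wave hab hneg hpos hk hy hys).1
    rw [(hasDerivAt_diffusivity a b _).deriv]
    exact ((hasDerivAt_diffusivity a b _).comp y hw).deriv
  rw [EventuallyEq.deriv_eq h1]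
  obtain ⟨hw, hD⟩ := hasDerivAt_wave hab hneg hpos hk hz0 hzs
  have hd : DifferentiableAt ℝ (fun w => deriv (diffusivity a b) w * waveSlope a b k w)
      (wave a b k z) := by
    have : deriv (diffusivity a b) = fun u => 2 * u - a - b :=
      funext fun u => (hasDerivAt_diffusivity a b u).deriv
    rw [this]
    unfold waveSlope
    exact DifferentiableAt.mul (by fun_prop)
      (((hasDerivAt_kirchhoff a b _).differentiableAt.const_mul k).div
        (hasDerivAt_diffusivity a b _).differentiableAt hD.ne')
  exact (hd.hasDerivAt.comp z hw).deriv

end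

end RecedingWave

open MeasureTheory Set Filter Topology

namespace RecedingWave

noncomputable section

open scoped ENNReal InnerProductSpace

/-! ### Integral operators with a doubly substochastic kernel -/

/-! Every `μ` with `Re μ ≥ 0` lies in the resolvent set: `𝓛 - μ` is inverted by an energy estimate
and Lax-Milgram, without ODE asymptotics. Write `d = D(ū)` and `r = R'(ū)`. On each side of the
shock `s`, `𝓛 p = (d p')' + (d' + c) p' + (d'' + r) p`. Pairing with `p`, taking real parts and
integrating `(d' + c) Re(p̄ p') = ½ (d' + c) (|p|²)'` by parts on both sides gives `Re ⟨p, 𝓛 p⟩ = -∫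
d |p'|² + ∫ (½ d'' + r) |p|² + ½ (d'(s-) - d'(s+)) |p(s)|²`. The constant drift `c` drops out, since
`p` vanishes at both ends. The middle integral is at most `-δ ‖p‖²`, because the stability condition
is strict on a compact set of values. The shock term is not positive (`diffusivityZ_shock_le`): `d'
= D'(ū) k Φ(ū) / D(ū)`, the quotient takes the same negative value at `u_l` and `u_r`, and `D'(u_l)
< D'(u_r)`. Hence the form is coercive on `H¹` functions vanishing at the front
(`IsDissipative.integral_le`, `isUnit_formOp`).

The unbounded problem becomes bounded through `q = p' - p`. The solution operator `backwardOp : q ↦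
p` is explicit, with a kernel controlled by Schur's test, and its adjoint `forwardOp` solves `w' =
-w - h`. The weak form of `(𝓛 - μ) p = f` is then `formOp q = forwardOp f` with `formOp` bounded on
`L²`, and the resolvent is `backwardOp ∘ formOp⁻¹ ∘ forwardOp`.

Weak and strong solutions agree, including the matching at the shock. The weak equation says that
the flux `w = d p'` is absolutely continuous across `s`; since `D(u_l) = D(u_r)`, `d` is continuous
there, so this amounts to `p` being `C¹` across `s` (`isImage_of_formOp_eq`,
`formOp_eq_of_isImage`). -/

/-- A kernel with values in `[0, 1]` and with row and column integrals at most one. -/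
structure IsSubstochastic {α : Type*} [MeasurableSpace α] (μ : Measure α) (κ : α → α → ℝ) :
    Prop where
  measurable : Measurable (Function.uncurry κ)
  nonneg : ∀ x y, 0 ≤ κ x y
  le_one : ∀ x y, κ x y ≤ 1
  row : ∀ x, ∫⁻ y, ENNReal.ofReal (κ x y) ∂μ ≤ 1
  col : ∀ y, ∫⁻ x, ENNReal.ofReal (κ x y) ∂μ ≤ 1

namespace IsSubstochastic

variable {α : Type*} [MeasurableSpace α] {μ : Measure α} {κ : α → α → ℝ}

theorem swap (h : IsSubstochastic μ κ) : IsSubstochastic μ (fun x y => κ y x) :=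
  ⟨h.measurable.comp measurable_swap, fun x y => h.nonneg y x, fun x y => h.le_one y x, h.col,
    h.row⟩

theorem measurable_row (h : IsSubstochastic μ κ) (x : α) : Measurable (κ x) :=
  h.measurable.comp measurable_prodMk_left

/-- Cauchy-Schwarz for the splitting `κ φ = κ^(1/2) (κ φ²)^(1/2)`, with the row bound on the first
factor. Together with the column bound in the next lemma this is Schur's test. -/
theorem lintegral_mul_sq_le (h : IsSubstochastic μ κ) {φ : α → ℝ≥0∞} (hφ : AEMeasurable φ μ)
    (x : α) : (∫⁻ y, ENNReal.ofReal (κ x y) * φ y ∂μ) ^ 2 ≤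
      ∫⁻ y, ENNReal.ofReal (κ x y) * φ y ^ 2 ∂μ := by
  have hm : Measurable fun y => ENNReal.ofReal (κ x y) := (h.measurable_row x).ennreal_ofReal
  have h1 := ENNReal.lintegral_mul_norm_pow_le (μ := μ) (p := 1 / 2) (q := 1 / 2)
    hm.aemeasurable (hm.aemeasurable.mul (hφ.pow_const 2)) (by norm_num) (by norm_num)
    (by norm_num)
  have h2 : ∀ y, ENNReal.ofReal (κ x y) ^ (1 / 2 : ℝ) *
      (ENNReal.ofReal (κ x y) * φ y ^ 2) ^ (1 / 2 : ℝ) = ENNReal.ofReal (κ x y) * φ y := by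
    intro y
    rw [ENNReal.mul_rpow_of_nonneg _ _ (by norm_num), ← mul_assoc,
      ← ENNReal.rpow_add_of_nonneg _ _ (by norm_num) (by norm_num), ← ENNReal.rpow_natCast,
      ← ENNReal.rpow_mul]
    norm_num
  simp only [Pi.mul_apply, h2] at h1
  calc (∫⁻ y, ENNReal.ofReal (κ x y) * φ y ∂μ) ^ 2
      ≤ ((∫⁻ y, ENNReal.ofReal (κ x y) ∂μ) ^ (1 / 2 : ℝ) *
        (∫⁻ y, ENNReal.ofReal (κ x y) * φ y ^ 2 ∂μ) ^ (1 / 2 : ℝ)) ^ 2 := by gcongr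
    _ ≤ (1 * (∫⁻ y, ENNReal.ofReal (κ x y) * φ y ^ 2 ∂μ) ^ (1 / 2 : ℝ)) ^ 2 := by
        gcongr
        exact ENNReal.rpow_le_one (h.row x) (by norm_num)
    _ = _ := by
        rw [one_mul, ← ENNReal.rpow_natCast, ← ENNReal.rpow_mul]
        norm_num

theorem lintegral_lintegral_mul_le [SFinite μ] (h : IsSubstochastic μ κ) {φ : α → ℝ≥0∞}
    (hφ : AEMeasurable φ μ) :
    ∫⁻ x, ∫⁻ y, ENNReal.ofReal (κ x y) * φ y ∂μ ∂μ ≤ ∫⁻ y, φ y ∂μ := by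
  rw [lintegral_lintegral_swap]
  · refine lintegral_mono_ae (Eventually.of_forall fun y => ?_)
    rw [lintegral_mul_const _ (h.swap.measurable_row y).ennreal_ofReal]
    exact mul_le_of_le_one_left (by simp) (h.col y)
  · exact h.measurable.ennreal_ofReal.aemeasurable.mul hφ.comp_snd

theorem enorm_mul_eq (h : IsSubstochastic μ κ) (q : ℂ) (x y : α) :
    ‖(κ x y : ℂ) * q‖ₑ = ENNReal.ofReal (κ x y) * ‖q‖ₑ := by
  rw [enorm_mul, ← ofReal_norm, Complex.norm_real, Real.norm_of_nonneg (h.nonneg x y)]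

theorem lintegral_sq_enorm_lt_top {q : α → ℂ} (hq : MemLp q 2 μ) :
    ∫⁻ y, ‖q y‖ₑ ^ 2 ∂μ < ∞ := by
  have := lintegral_rpow_enorm_lt_top_of_eLpNorm_lt_top two_ne_zero ENNReal.ofNat_ne_top hq.2
  simpa using this

/-- The bound `κ ≤ 1` gives integrability for every `x`, not just almost every `x`, so the kernel
integral can be handled pointwise. -/
theorem integrable_mul (h : IsSubstochastic μ κ) {q : α → ℂ} (hq : MemLp q 2 μ)
    (x : α) : Integrable (fun y => (κ x y : ℂ) * q y) μ := by
  refine ⟨(Complex.measurable_ofReal.comp (h.measurable_row x)).aestronglyMeasurable.mul hq.1, ?_⟩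
  have h1 := h.lintegral_mul_sq_le hq.1.enorm x
  have h2 : ∫⁻ y, ENNReal.ofReal (κ x y) * ‖q y‖ₑ ^ 2 ∂μ ≤ ∫⁻ y, ‖q y‖ₑ ^ 2 ∂μ :=
    lintegral_mono fun y =>
      mul_le_of_le_one_left (by simp) (ENNReal.ofReal_le_one.2 (h.le_one x y))
  rw [hasFiniteIntegral_iff_enorm]
  simp only [h.enorm_mul_eq]
  by_contra hc
  rw [not_lt, top_le_iff] at hc
  rw [hc] at h1
  exact absurd (h1.trans h2) (by simpa using (lintegral_sq_enorm_lt_top hq).ne)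

theorem memLp_integral [SFinite μ] (h : IsSubstochastic μ κ) {q : α → ℂ} (hq : MemLp q 2 μ) :
    MemLp (fun x => ∫ y, (κ x y : ℂ) * q y ∂μ) 2 μ ∧
      eLpNorm (fun x => ∫ y, (κ x y : ℂ) * q y ∂μ) 2 μ ≤ eLpNorm q 2 μ := by
  have hm : AEStronglyMeasurable (fun x => ∫ y, (κ x y : ℂ) * q y ∂μ) μ :=
    AEStronglyMeasurable.integral_prod_right' (f := fun z : α × α => (κ z.1 z.2 : ℂ) * q z.2)
      ((Complex.measurable_ofReal.comp h.measurable).aestronglyMeasurable.mul hq.1.comp_snd)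
  have hle : eLpNorm (fun x => ∫ y, (κ x y : ℂ) * q y ∂μ) 2 μ ≤ eLpNorm q 2 μ := by
    rw [eLpNorm_eq_lintegral_rpow_enorm_toReal two_ne_zero ENNReal.ofNat_ne_top,
      eLpNorm_eq_lintegral_rpow_enorm_toReal two_ne_zero ENNReal.ofNat_ne_top]
    refine ENNReal.rpow_le_rpow ?_ (by positivity)
    simp only [ENNReal.toReal_ofNat, ENNReal.rpow_ofNat]
    refine le_trans (lintegral_mono fun x => ?_)
      (h.lintegral_lintegral_mul_le (hq.1.enorm.pow_const 2))
    refine le_trans ?_ (h.lintegral_mul_sq_le hq.1.enorm x)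
    gcongr
    refine (enorm_integral_le_lintegral_enorm _).trans_eq (lintegral_congr fun y => ?_)
    exact h.enorm_mul_eq _ x y
  exact ⟨⟨hm, hle.trans_lt hq.2⟩, hle⟩

/-- The operator on `L²` with kernel `κ`. -/
def op [SFinite μ] (h : IsSubstochastic μ κ) : Lp ℂ 2 μ →L[ℂ] Lp ℂ 2 μ :=
  LinearMap.mkContinuous
    { toFun := fun q => (h.memLp_integral (Lp.memLp q)).1.toLp _
      map_add' := fun q q' => by
        rw [← MemLp.toLp_add, MemLp.toLp_eq_toLp_iff]
        refine Eventually.of_forall fun x => ?_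
        rw [Pi.add_apply, ← integral_add (h.integrable_mul (Lp.memLp q) x)
          (h.integrable_mul (Lp.memLp q') x)]
        refine integral_congr_ae ?_
        filter_upwards [Lp.coeFn_add q q'] with y hy
        rw [hy, Pi.add_apply, mul_add]
      map_smul' := fun c q => by
        rw [RingHom.id_apply, ← MemLp.toLp_const_smul, MemLp.toLp_eq_toLp_iff]
        refine Eventually.of_forall fun x => ?_
        rw [Pi.smul_apply, ← integral_smul]
        refine integral_congr_ae ?_
        filter_upwards [Lp.coeFn_smul c q] with y hy
        rw [hy, Pi.smul_apply, smul_eq_mul, smul_eq_mul, mul_left_comm] }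
    1 fun q => by
      rw [one_mul, Lp.norm_def]
      refine ENNReal.toReal_mono (Lp.eLpNorm_ne_top q) ?_
      refine le_trans (le_of_eq ?_) (h.memLp_integral (Lp.memLp q)).2
      exact eLpNorm_congr_ae (h.memLp_integral (Lp.memLp q)).1.coeFn_toLp

theorem coeFn_op [SFinite μ] (h : IsSubstochastic μ κ) (q : Lp ℂ 2 μ) :
    h.op q =ᵐ[μ] fun x => ∫ y, (κ x y : ℂ) * q y ∂μ :=
  (h.memLp_integral (Lp.memLp q)).1.coeFn_toLp

/-- Since `|q| |p| ≤ |q|² + |p|²`, the column bound controls the part with `q` and the row bound the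
part with `p`. This justifies Fubini for the adjoint. -/
theorem integrable_prod [SFinite μ] (h : IsSubstochastic μ κ) {p q : α → ℂ} (hp : MemLp p 2 μ)
    (hq : MemLp q 2 μ) :
    Integrable (fun z : α × α => (κ z.1 z.2 : ℂ) * q z.2 * p z.1) (μ.prod μ) := by
  have hκ : AEStronglyMeasurable (fun z : α × α => (κ z.1 z.2 : ℂ)) (μ.prod μ) :=
    (Complex.measurable_ofReal.comp h.measurable).aestronglyMeasurable
  have hm : AEMeasurable (fun z : α × α => ENNReal.ofReal (κ z.1 z.2)) (μ.prod μ) :=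
    h.measurable.ennreal_ofReal.aemeasurable
  have h1 : ∫⁻ z, ENNReal.ofReal (κ z.1 z.2) * ‖q z.2‖ₑ ^ 2 ∂(μ.prod μ) < ∞ := by
    refine lt_of_eq_of_lt (lintegral_prod _ (hm.mul (hq.1.comp_snd.enorm.pow_const 2))) ?_
    exact (h.lintegral_lintegral_mul_le (hq.1.enorm.pow_const 2)).trans_lt
      (lintegral_sq_enorm_lt_top hq)
  have h2 : ∫⁻ z, ENNReal.ofReal (κ z.1 z.2) * ‖p z.1‖ₑ ^ 2 ∂(μ.prod μ) < ∞ := by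
    refine lt_of_eq_of_lt
      (lintegral_prod_symm _ (hm.mul (hp.1.comp_fst.enorm.pow_const 2))) ?_
    exact (h.swap.lintegral_lintegral_mul_le (hp.1.enorm.pow_const 2)).trans_lt
      (lintegral_sq_enorm_lt_top hp)
  refine ⟨(hκ.mul hq.1.comp_snd).mul hp.1.comp_fst, ?_⟩
  rw [hasFiniteIntegral_iff_enorm]
  refine lt_of_le_of_lt (lintegral_mono fun z => ?_)
    (lt_of_eq_of_lt (lintegral_add_left' (hm.mul (hq.1.comp_snd.enorm.pow_const 2)) _)
      (ENNReal.add_lt_top.2 ⟨h1, h2⟩))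
  simp only [Pi.mul_apply]
  rw [enorm_mul, h.enorm_mul_eq, mul_assoc, ← mul_add]
  gcongr
  rcases le_total ‖q z.2‖ₑ ‖p z.1‖ₑ with hle | hle
  · refine le_trans ?_ le_add_self
    rw [sq]; gcongr
  · refine le_trans ?_ le_self_add
    rw [sq]; gcongr

theorem integral_integral_swap_mul [SFinite μ] (h : IsSubstochastic μ κ) {p q : α → ℂ}
    (hp : MemLp p 2 μ) (hq : MemLp q 2 μ) :
    ∫ x, ∫ y, (κ x y : ℂ) * q y * p x ∂μ ∂μ = ∫ y, ∫ x, (κ x y : ℂ) * q y * p x ∂μ ∂μ :=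
  integral_integral_swap (f := fun x y => (κ x y : ℂ) * q y * p x) (h.integrable_prod hp hq)

theorem inner_op_left [SFinite μ] (h : IsSubstochastic μ κ) (q p : Lp ℂ 2 μ) :
    ⟪h.op q, p⟫_ℂ = ⟪q, h.swap.op p⟫_ℂ := by
  have hq : MemLp (fun y => (starRingEnd ℂ) (q y)) 2 μ := (Lp.memLp q).star
  rw [L2.inner_def, L2.inner_def]
  have h1 : ∫ x, ⟪h.op q x, p x⟫_ℂ ∂μ =
      ∫ x, ∫ y, (κ x y : ℂ) * (starRingEnd ℂ) (q y) * p x ∂μ ∂μ := by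
    refine integral_congr_ae ?_
    filter_upwards [h.coeFn_op q] with x hx
    rw [hx, integral_mul_const, RCLike.inner_apply, ← integral_conj, mul_comm]
    simp only [map_mul, Complex.conj_ofReal]
  have h2 : ∫ y, ⟪q y, h.swap.op p y⟫_ℂ ∂μ =
      ∫ y, ∫ x, (κ x y : ℂ) * (starRingEnd ℂ) (q y) * p x ∂μ ∂μ := by
    refine integral_congr_ae ?_
    filter_upwards [h.swap.coeFn_op p] with y hy
    simp_rw [mul_right_comm _ ((starRingEnd ℂ) (q y))]
    rw [hy, RCLike.inner_apply, integral_mul_const]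
  have h3 : ∫ x, ∫ y, (κ x y : ℂ) * (starRingEnd ℂ) (q y) * p x ∂μ ∂μ =
      ∫ y, ∫ x, (κ x y : ℂ) * (starRingEnd ℂ) (q y) * p x ∂μ ∂μ :=
    h.integral_integral_swap_mul (Lp.memLp p) hq
  exact h1.trans (h3.trans h2.symm)

end IsSubstochastic

/-! ### Calculus of locally absolutely continuous functions -/

/-- Integration by parts for absolutely continuous functions; by Lebesgue differentiation the
derivatives of the two primitives are almost everywhere `g` and `h`. -/
theorem integral_deriv_mul_primitive {g h : ℝ → ℝ} {x y : ℝ} (hg : IntervalIntegrable g volume x y)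
    (hh : IntervalIntegrable h volume x y) (α β : ℝ) :
    ∫ t in x..y, (g t * (β + ∫ u in x..t, h u) + (α + ∫ u in x..t, g u) * h t) =
      (α + ∫ u in x..y, g u) * (β + ∫ u in x..y, h u) - α * β := by
  have key : ∀ {g : ℝ → ℝ} (_ : IntervalIntegrable g volume x y) (α : ℝ),
      AbsolutelyContinuousOnInterval (fun t => α + ∫ u in x..t, g u) x y := fun hg α =>
    ((LipschitzWith.const α).lipschitzOnWith.absolutelyContinuousOnInterval).add
      (hg.absolutelyContinuousOnInterval_intervalIntegral left_mem_uIcc)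
  have h1 := (key hg α).integral_deriv_mul_eq_sub (key hh β)
  simp only [intervalIntegral.integral_same, add_zero] at h1
  rw [← h1]
  refine intervalIntegral.integral_congr_ae ?_
  filter_upwards [hg.ae_hasDerivAt_integral, hh.ae_hasDerivAt_integral] with t e1 e2 ht
  have ht' := uIoc_subset_uIcc ht
  rw [((e1 ht' x left_mem_uIcc).const_add α).deriv, ((e2 ht' x left_mem_uIcc).const_add β).deriv]

theorem sub_eq_integral_mul {E E' f g : ℝ → ℝ} {x y : ℝ}
    (hE : IntervalIntegrable E' volume x y) (hE' : ∀ z ∈ uIcc x y, E z - E x = ∫ t in x..z, E' t)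
    (hf : IntervalIntegrable g volume x y) (hf' : ∀ z ∈ uIcc x y, f z - f x = ∫ t in x..z, g t) :
    E y * f y - E x * f x = ∫ t in x..y, (E' t * f t + E t * g t) := by
  have h1 := integral_deriv_mul_primitive hE hf (E x) (f x)
  rw [← hE' y right_mem_uIcc, ← hf' y right_mem_uIcc] at h1
  rw [add_sub_cancel, add_sub_cancel] at h1
  rw [← h1]
  refine intervalIntegral.integral_congr fun t ht => ?_
  rw [← hE' t ht, ← hf' t ht, add_sub_cancel, add_sub_cancel]

namespace HasACDerivOn

variable {F G : ℝ → ℂ} {I : Set ℝ}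

theorem mono (h : HasACDerivOn F G I) {J : Set ℝ} (hJ : J ⊆ I) : HasACDerivOn F G J :=
  fun x hx y hy => h x (hJ hx) y (hJ hy)

theorem congr [OrdConnected I] (h : HasACDerivOn F G I) {F' G' : ℝ → ℂ}
    (hF : ∀ z ∈ I, F' z = F z) (hG : G' =ᵐ[volume.restrict I] G) : HasACDerivOn F' G' I := by
  intro x hx y hy
  obtain ⟨h1, h2⟩ := h x hx y hy
  have hsub : uIoc x y ⊆ I := uIoc_subset_uIcc.trans (OrdConnected.uIcc_subset ‹_› hx hy)
  have hG' : G' =ᵐ[volume.restrict (uIoc x y)] G := ae_restrict_of_ae_restrict_of_subset hsub hG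
  refine ⟨h1.congr_ae hG'.symm, ?_⟩
  rw [hF x hx, hF y hy, h2]
  refine intervalIntegral.integral_congr_ae_restrict hG'.symm

theorem of_hasDerivAt [OrdConnected I] (h : ∀ z ∈ I, HasDerivAt F (G z) z)
    (hG : ContinuousOn G I) : HasACDerivOn F G I := by
  intro x hx y hy
  have hsub : uIcc x y ⊆ I := OrdConnected.uIcc_subset ‹_› hx hy
  have hi : IntervalIntegrable G volume x y := (hG.mono hsub).intervalIntegrable
  exact ⟨hi, (intervalIntegral.integral_eq_sub_of_hasDerivAt (fun z hz => h z (hsub hz)) hi).symm⟩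

theorem continuousOn (hI : IsOpen I) (h : HasACDerivOn F G I) :
    ContinuousOn F I := by
  intro x hx
  obtain ⟨ε, hε, hball⟩ := Metric.isOpen_iff.1 hI x hx
  rw [Real.ball_eq_Ioo] at hball
  have h1 : x - ε / 2 ∈ I := hball ⟨by linarith, by linarith⟩
  have h2 : x + ε / 2 ∈ I := hball ⟨by linarith, by linarith⟩
  have hle : x - ε / 2 ≤ x + ε / 2 := by linarith
  have hc := intervalIntegral.continuousOn_primitive_interval' (h _ h1 _ h2).1 left_mem_uIcc
  rw [uIcc_of_le hle] at hc
  have hn : Icc (x - ε / 2) (x + ε / 2) ∈ 𝓝 x := Icc_mem_nhds (by linarith) (by linarith)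
  have hc' := ((continuousOn_const (c := F (x - ε / 2))).add hc).continuousAt hn
  refine (hc'.congr ?_).continuousWithinAt
  filter_upwards [hn] with z hz
  have := (h _ h1 z (hball ⟨by linarith [hz.1], by linarith [hz.2]⟩)).2
  simp [← this]

theorem hasDerivAt (hI : IsOpen I) [OrdConnected I] (h : HasACDerivOn F G I) (hG : ContinuousOn G I)
    {x : ℝ} (hx : x ∈ I) : HasDerivAt F (G x) x := by
  obtain ⟨ε, hε, hball⟩ := Metric.isOpen_iff.1 hI x hx
  rw [Real.ball_eq_Ioo] at hball
  have h1 : x - ε / 2 ∈ I := hball ⟨by linarith, by linarith⟩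
  have hd := intervalIntegral.integral_hasDerivAt_right (h _ h1 _ hx).1
    (hG.stronglyMeasurableAtFilter hI x hx) (hG.continuousAt (hI.mem_nhds hx))
  refine (hd.const_add (F (x - ε / 2))).congr_of_eventuallyEq ?_
  filter_upwards [hI.mem_nhds hx] with z hz
  rw [← (h _ h1 z hz).2, add_sub_cancel]

/-- The product rule with a `C¹` real factor. The integration by parts above is for real functions,
so real and imaginary parts are treated separately. -/
theorem ofReal_mul [OrdConnected I] {E E' : ℝ → ℝ} (h : HasACDerivOn F G I)
    (hE : ∀ z ∈ I, HasDerivAt E (E' z) z) (hE' : ContinuousOn E' I) :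
    HasACDerivOn (fun z => (E z : ℂ) * F z) (fun z => (E' z : ℂ) * F z + (E z : ℂ) * G z) I := by
  intro x hx y hy
  have hsub : uIcc x y ⊆ I := OrdConnected.uIcc_subset ‹_› hx hy
  have hG := (h x hx y hy).1
  have hEc : ContinuousOn E (uIcc x y) := fun z hz =>
    (hE z (hsub hz)).continuousAt.continuousWithinAt
  have hFc : ContinuousOn F (uIcc x y) := by
    have hc := intervalIntegral.continuousOn_primitive_interval' hG left_mem_uIcc
    refine ((continuousOn_const (c := F x)).add hc).congr fun z hz => ?_
    simp [← (h x hx z (hsub hz)).2]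
  have hEi : IntervalIntegrable E' volume x y := (hE'.mono hsub).intervalIntegrable
  have hEF : ∀ z ∈ uIcc x y, E z - E x = ∫ t in x..z, E' t := fun z hz =>
    (intervalIntegral.integral_eq_sub_of_hasDerivAt
      (fun t ht => hE t (hsub (uIcc_subset_uIcc_left hz ht)))
      (hEi.mono_set (uIcc_subset_uIcc_left hz))).symm
  have hEG : IntervalIntegrable (fun z => (E' z : ℂ) * F z + (E z : ℂ) * G z) volume x y := by
    refine IntervalIntegrable.add ?_ ?_
    · exact ((Complex.continuous_ofReal.comp_continuousOn (hE'.mono hsub)).mul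
        hFc).intervalIntegrable
    · exact hG.continuousOn_mul (Complex.continuous_ofReal.comp_continuousOn hEc)
  have hre : IntervalIntegrable (fun t => (G t).re) volume x y := ⟨hG.1.re, hG.2.re⟩
  have him : IntervalIntegrable (fun t => (G t).im) volume x y := ⟨hG.1.im, hG.2.im⟩
  have hcre : ∀ {K : ℝ → ℂ} {z : ℝ}, IntervalIntegrable K volume x z →
      (∫ t in x..z, K t).re = ∫ t in x..z, (K t).re := fun hK =>
    (Complex.reCLM.intervalIntegral_comp_comm hK).symm
  have hcim : ∀ {K : ℝ → ℂ} {z : ℝ}, IntervalIntegrable K volume x z →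
      (∫ t in x..z, K t).im = ∫ t in x..z, (K t).im := fun hK =>
    (Complex.imCLM.intervalIntegral_comp_comm hK).symm
  refine ⟨hEG, Complex.ext ?_ ?_⟩
  · have := sub_eq_integral_mul (f := fun t => (F t).re) hEi hEF hre fun z hz => by
      rw [← hcre (h x hx z (hsub hz)).1, ← (h x hx z (hsub hz)).2, Complex.sub_re]
    rw [hcre hEG]
    simpa using this
  · have := sub_eq_integral_mul (f := fun t => (F t).im) hEi hEF him fun z hz => by
      rw [← hcim (h x hx z (hsub hz)).1, ← (h x hx z (hsub hz)).2, Complex.sub_im]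
    rw [hcim hEG]
    simpa using this

/-- A function that is absolutely continuous on both sides of `s` and continuous at `s` is
absolutely continuous. -/
theorem glue {s e : ℝ} (hs : s < e) (hl : HasACDerivOn F G (Iio s))
    (hr : HasACDerivOn F G (Ioo s e))
    (hc : ContinuousAt F s)
    (hG : ∀ x ∈ Iio e, ∀ y ∈ Iio e, IntervalIntegrable G volume x y) :
    HasACDerivOn F G (Iio e) := by
  have key : ∀ y ∈ Iio e, F y - F s = ∫ t in s..y, G t := by
    -- `F` minus a primitive of `G` is constant on each side of `s` and continuous at `s`, so both
    -- constants equal its value at `s`.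
    have hcH : ContinuousAt (fun x => F x - ∫ t in s..x, G t) s := by
      refine hc.sub ?_
      have hm : (s + e) / 2 ∈ Iio e := by simp only [mem_Iio]; linarith
      have hm' : s - 1 ∈ Iio e := by simp only [mem_Iio]; linarith
      have h1 : s - 1 ≤ (s + e) / 2 := by linarith
      have := intervalIntegral.continuousOn_primitive_interval' (a := s) (hG _ hm' _ hm)
        (by rw [uIcc_of_le h1]; constructor <;> linarith)
      rw [uIcc_of_le h1] at this
      exact this.continuousAt (Icc_mem_nhds (by linarith) (by linarith))
    have hconst : ∀ J : Set ℝ, HasACDerivOn F G J → J ⊆ Iio e → ∀ y ∈ J, ∀ x ∈ J,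
        F x - ∫ t in s..x, G t = F y - ∫ t in s..y, G t := by
      intro J hJ hJe y hy x hx
      have h1 := (hJ x hx y hy).2
      rw [← intervalIntegral.integral_interval_sub_left (hG s hs y (hJe hy))
        (hG s hs x (hJe hx))] at h1
      linear_combination -h1
    intro y hy
    rcases lt_trichotomy y s with h | h | h
    · have h1 : Tendsto (fun x => F x - ∫ t in s..x, G t) (𝓝[<] s)
          (𝓝 (F y - ∫ t in s..y, G t)) := by
        refine tendsto_const_nhds.congr' ?_
        filter_upwards [self_mem_nhdsWithin] with x hx
        exact (hconst _ hl (Iio_subset_Iio hs.le) y h x hx).symm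
      have := tendsto_nhds_unique h1 (hcH.tendsto.mono_left nhdsWithin_le_nhds)
      simp only [intervalIntegral.integral_same] at this
      linear_combination this
    · simp [h]
    · have h1 : Tendsto (fun x => F x - ∫ t in s..x, G t) (𝓝[>] s)
          (𝓝 (F y - ∫ t in s..y, G t)) := by
        refine tendsto_const_nhds.congr' ?_
        filter_upwards [Ioo_mem_nhdsGT hs] with x hx
        exact (hconst _ hr (fun z hz => hz.2) y ⟨h, hy⟩ x hx).symm
      have := tendsto_nhds_unique h1 (hcH.tendsto.mono_left nhdsWithin_le_nhds)
      simp only [intervalIntegral.integral_same] at this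
      linear_combination this
  intro x hx y hy
  refine ⟨hG x hx y hy, ?_⟩
  rw [← intervalIntegral.integral_interval_sub_left (hG s hs y hy) (hG s hs x hx), ← key y hy,
    ← key x hx]
  ring

/-- The integrating factor `exp (-α z)` makes the derivative vanish. Uniqueness for both first-order
problems below rests on this. -/
theorem eq_exp [OrdConnected I] {α : ℝ} (h : HasACDerivOn F (fun z => (α : ℂ) * F z) I) :
    ∃ C : ℂ, ∀ z ∈ I, F z = (Real.exp (α * z) : ℂ) * C := by
  rcases I.eq_empty_or_nonempty with rfl | ⟨x, hx⟩
  · exact ⟨0, by simp⟩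
  have hE : ∀ z ∈ I, HasDerivAt (fun z => Real.exp (-α * z)) (-α * Real.exp (-α * z)) z := by
    intro z _
    have := ((hasDerivAt_id z).const_mul (-α)).exp
    simpa [mul_comm] using this
  have h1 := h.ofReal_mul hE (by fun_prop)
  refine ⟨(Real.exp (-α * x) : ℂ) * F x, fun z hz => ?_⟩
  have h2 := (h1 x hx z hz).2
  rw [intervalIntegral.integral_congr (g := fun _ => 0) (fun t _ => by push_cast; ring)] at h2
  rw [intervalIntegral.integral_zero, sub_eq_zero] at h2
  simp only at h2
  rw [← h2, ← mul_assoc, ← Complex.ofReal_mul, ← Real.exp_add]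
  simp

end HasACDerivOn

local notation "ν" => (Measure.restrict (volume : Measure ℝ) (Iio (0 : ℝ)))

/-! ### The first-order operators on the half line -/

/-- The Green kernel of `p' - p = -q`, `p(0) = 0`, on the half line. -/
def expKernel (z t : ℝ) : ℝ := if z < t then Real.exp (z - t) else 0

theorem isSubstochastic_expKernel : IsSubstochastic ν expKernel where
  measurable := by
    unfold expKernel Function.uncurry
    exact Measurable.ite (measurableSet_lt measurable_fst measurable_snd) (by fun_prop)
      measurable_const
  nonneg z t := by unfold expKernel; split_ifs <;> positivity
  le_one z t := by
    unfold expKernel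
    split_ifs with h
    · exact Real.exp_le_one_iff.2 (by linarith)
    · exact zero_le_one
  row z := by
    calc ∫⁻ t, ENNReal.ofReal (expKernel z t) ∂ν
        ≤ ∫⁻ t, ENNReal.ofReal (expKernel z t) := setLIntegral_le_lintegral _ _
      _ = ∫⁻ t in Ioi z, ENNReal.ofReal (Real.exp z * Real.exp (-t)) := by
          rw [← lintegral_indicator measurableSet_Ioi]
          refine lintegral_congr fun t => ?_
          by_cases h : z < t <;> simp [expKernel, h, sub_eq_add_neg, Real.exp_add]
      _ = ENNReal.ofReal (∫ t in Ioi z, Real.exp z * Real.exp (-t)) :=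
          (ofReal_integral_eq_lintegral_ofReal
            ((integrableOn_exp_neg_Ioi z).const_mul _)
            (Eventually.of_forall fun t => by positivity)).symm
      _ ≤ 1 := by
          rw [integral_const_mul, integral_exp_neg_Ioi, ← Real.exp_add]
          simp
  col t := by
    calc ∫⁻ z, ENNReal.ofReal (expKernel z t) ∂ν
        ≤ ∫⁻ z, ENNReal.ofReal (expKernel z t) := setLIntegral_le_lintegral _ _
      _ = ∫⁻ z in Iio t, ENNReal.ofReal (Real.exp (-t) * Real.exp z) := by
          rw [← lintegral_indicator measurableSet_Iio]
          refine lintegral_congr fun z => ?_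
          by_cases h : z < t <;>
            simp [expKernel, h, sub_eq_add_neg, Real.exp_add, mul_comm]
      _ = ∫⁻ z in Iic t, ENNReal.ofReal (Real.exp (-t) * Real.exp z) := by
          rw [restrict_Iio_eq_restrict_Iic]
      _ = ENNReal.ofReal (∫ z in Iic t, Real.exp (-t) * Real.exp z) :=
          (ofReal_integral_eq_lintegral_ofReal
            ((integrableOn_exp_Iic t).const_mul _)
            (Eventually.of_forall fun t => by positivity)).symm
      _ ≤ 1 := by
          rw [integral_const_mul, integral_exp_Iic, ← Real.exp_add]
          simp

/-- The solution `p` of `p' - p = q`, `p(0) = 0`. -/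
def backward (q : ℝ → ℂ) (z : ℝ) : ℂ := -∫ t, (expKernel z t : ℂ) * q t ∂ν

/-- The decaying solution `w` of `w' = -w - h`. -/
def forward (h : ℝ → ℂ) (t : ℝ) : ℂ := -∫ z, (expKernel z t : ℂ) * h z ∂ν

theorem intervalIntegrable_of_memLp {q : ℝ → ℂ} (hq : MemLp q 2 ν) {x y : ℝ} (hx : x ≤ 0)
    (hy : y ≤ 0) : IntervalIntegrable q volume x y := by
  rw [intervalIntegrable_iff]
  have hsub : uIoc x y ⊆ Iic 0 := fun z hz => hz.2.trans (max_le hx hy)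
  have h1 : MemLp q 2 (volume.restrict (Iic 0)) := by rwa [← restrict_Iio_eq_restrict_Iic]
  have : IsFiniteMeasure (volume.restrict (uIoc x y)) := ⟨by simp [uIoc]⟩
  exact (h1.mono_measure (Measure.restrict_mono_set _ hsub)).integrable one_le_two

theorem backward_eq {q : ℝ → ℂ} {z : ℝ} (hz : z < 0) :
    backward q z = (Real.exp z : ℂ) * -∫ t in z..0, (Real.exp (-t) : ℂ) * q t := by
  rw [backward, intervalIntegral.integral_of_le hz.le, ← restrict_Ioo_eq_restrict_Ioc, mul_neg,
    ← integral_const_mul, ← integral_indicator measurableSet_Iio,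
    ← integral_indicator measurableSet_Ioo]
  congr 2
  funext t
  by_cases h0 : t < 0 <;> by_cases h : z < t <;>
    simp [h0, h, expKernel, indicator, sub_eq_add_neg, Real.exp_add, mul_assoc]

theorem forward_eq {h : ℝ → ℂ} {t : ℝ} (ht : t < 0) :
    forward h t = (Real.exp (-t) : ℂ) * -∫ z in Iic t, (Real.exp z : ℂ) * h z := by
  rw [forward, ← restrict_Iio_eq_restrict_Iic, mul_neg,
    ← integral_const_mul, ← integral_indicator measurableSet_Iio,
    ← integral_indicator measurableSet_Iio]
  congr 2
  funext z
  by_cases h0 : z < t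
  · simp [h0, h0.trans ht, expKernel, indicator, sub_eq_add_neg, Complex.exp_add]
    ring
  · simp [h0, expKernel, indicator]

theorem memLp_exp : MemLp (fun z => (Real.exp z : ℂ)) 2 ν := by
  rw [memLp_two_iff_integrable_sq_norm (by fun_prop)]
  have h : Integrable Real.exp ν := by
    rw [restrict_Iio_eq_restrict_Iic]; exact integrableOn_exp_Iic 0
  refine h.mono' (by fun_prop) ?_
  filter_upwards [ae_restrict_mem measurableSet_Iio] with z hz
  rw [Complex.norm_real, Real.norm_of_nonneg (Real.exp_pos z).le,
    Real.norm_of_nonneg (by positivity), sq]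
  exact mul_le_of_le_one_left (Real.exp_pos z).le (Real.exp_le_one_iff.2 (le_of_lt hz))

theorem integrable_exp_mul {h : ℝ → ℂ} (hh : MemLp h 2 ν) :
    Integrable (fun z => (Real.exp z : ℂ) * h z) ν :=
  memLp_exp.integrable_mul hh

theorem hasACDerivOn_backward {q : ℝ → ℂ} (hq : MemLp q 2 ν) :
    HasACDerivOn (backward q) (fun z => backward q z + q z) (Iio 0) := by
  have hi : ∀ x ≤ 0, ∀ y ≤ 0,
      IntervalIntegrable (fun t => (Real.exp (-t) : ℂ) * q t) volume x y := fun x hx y hy =>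
    (intervalIntegrable_of_memLp hq hx hy).continuousOn_mul (by fun_prop)
  have h1 : HasACDerivOn (fun z => -∫ t in z..0, (Real.exp (-t) : ℂ) * q t)
      (fun t => (Real.exp (-t) : ℂ) * q t) (Iio 0) := by
    intro x hx y hy
    refine ⟨hi x hx.le y hy.le, ?_⟩
    have := intervalIntegral.integral_add_adjacent_intervals (hi x hx.le y hy.le)
      (hi y hy.le 0 le_rfl)
    simp only
    rw [← this]
    ring
  refine (h1.ofReal_mul (E := Real.exp) (E' := Real.exp) (fun z _ => Real.hasDerivAt_exp z)
    Real.continuous_exp.continuousOn).congr (fun z hz => backward_eq hz) ?_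
  filter_upwards [ae_restrict_mem measurableSet_Iio] with z hz
  rw [backward_eq hz, ← mul_assoc, ← Complex.ofReal_mul, ← Real.exp_add]
  simp

theorem hasACDerivOn_forward {h : ℝ → ℂ} (hh : MemLp h 2 ν) :
    HasACDerivOn (forward h) (fun z => -forward h z - h z) (Iio 0) := by
  have hI : IntegrableOn (fun z => (Real.exp z : ℂ) * h z) (Iio 0) := integrable_exp_mul hh
  have h1 : HasACDerivOn (fun t => -∫ z in Iic t, (Real.exp z : ℂ) * h z)
      (fun z => -((Real.exp z : ℂ) * h z)) (Iio 0) := by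
    intro x hx y hy
    refine ⟨IntervalIntegrable.neg ?_, ?_⟩
    · exact (intervalIntegrable_of_memLp hh (le_of_lt hx) (le_of_lt hy)).continuousOn_mul
        (by fun_prop)
    rw [intervalIntegral.integral_neg, ← intervalIntegral.integral_Iic_sub_Iic
      (hI.mono_set (Iic_subset_Iio.2 hx)) (hI.mono_set (Iic_subset_Iio.2 hy))]
    ring
  have hE : ∀ z ∈ Iio (0 : ℝ), HasDerivAt (fun z => Real.exp (-z)) (-Real.exp (-z)) z := by
    intro z _
    simpa using (hasDerivAt_id z).neg.exp
  refine (h1.ofReal_mul hE (by fun_prop)).congr (fun z hz => forward_eq hz) ?_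
  filter_upwards [ae_restrict_mem measurableSet_Iio] with z hz
  rw [forward_eq hz, mul_neg, mul_neg, mul_neg, ← mul_assoc, ← Complex.ofReal_mul, ← Real.exp_add]
  simp [sub_eq_add_neg]

theorem tendsto_backward_zero {q : ℝ → ℂ} (hq : MemLp q 2 ν) :
    Tendsto (backward q) (𝓝[<] 0) (𝓝 0) := by
  have hi : IntervalIntegrable (fun t => (Real.exp (-t) : ℂ) * q t) volume 0 (-1) :=
    (intervalIntegrable_of_memLp hq le_rfl (by norm_num)).continuousOn_mul (by fun_prop)
  have hc := intervalIntegral.continuousOn_primitive_interval' hi left_mem_uIcc 0 left_mem_uIcc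
  have h1 : Tendsto (fun z => (Real.exp z : ℂ) * ∫ t in (0 : ℝ)..z, (Real.exp (-t) : ℂ) * q t)
      (𝓝[<] 0) (𝓝 ((Real.exp 0 : ℂ) * 0)) := by
    refine Tendsto.mul ?_ ?_
    · exact (Continuous.tendsto (by fun_prop) _).mono_left nhdsWithin_le_nhds
    · have h2 : 𝓝[<] (0 : ℝ) ≤ 𝓝[uIcc 0 (-1)] 0 := by
        rw [uIcc_of_ge (by norm_num)]
        exact nhdsWithin_le_iff.2 (mem_of_superset (Ioo_mem_nhdsLT (by norm_num : (-1 : ℝ) < 0))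
          Ioo_subset_Icc_self)
      have := hc.tendsto.mono_left h2
      simpa using this
  rw [mul_zero] at h1
  refine h1.congr' ?_
  filter_upwards [self_mem_nhdsWithin] with z hz
  rw [backward_eq hz, intervalIntegral.integral_symm 0 z, neg_neg]

/-- Both sides solve `p' - p = P₁ - P`, so they differ by `C exp z`; the boundary value at the front
forces `C = 0`. -/
theorem eqOn_backward {P P₁ : ℝ → ℂ} (hP : HasACDerivOn P P₁ (Iio 0))
    (h0 : Tendsto P (𝓝[<] 0) (𝓝 0))
    (hq : MemLp (P₁ - P) 2 ν) : ∀ z < 0, P z = backward (P₁ - P) z := by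
  have h1 := hP.add ((hasACDerivOn_backward hq).smul (-1))
  obtain ⟨C, hC⟩ := HasACDerivOn.eq_exp (α := 1) (h1.congr (fun _ _ => rfl)
    (Eventually.of_forall fun z => by simp; ring))
  have h2 : Tendsto (fun z => (Real.exp (1 * z) : ℂ) * C) (𝓝[<] 0) (𝓝 C) := by
    have : Continuous fun z : ℝ => (Real.exp (1 * z) : ℂ) * C := by fun_prop
    simpa using (this.tendsto 0).mono_left (nhdsWithin_le_nhds (s := Iio 0))
  have h3 : Tendsto (P + (-1 : ℂ) • backward (P₁ - P)) (𝓝[<] 0) (𝓝 0) := by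
    have := h0.add ((tendsto_backward_zero hq).const_smul (-1 : ℂ))
    rwa [smul_zero, add_zero] at this
  have hC0 : C = 0 := tendsto_nhds_unique h2 (h3.congr' (by
    filter_upwards [self_mem_nhdsWithin] with z hz using hC z hz))
  intro z hz
  have := hC z hz
  rw [hC0] at this
  simp at this
  linear_combination this

theorem memLp_backward {q : ℝ → ℂ} (hq : MemLp q 2 ν) : MemLp (backward q) 2 ν :=
  (isSubstochastic_expKernel.memLp_integral hq).1.neg

theorem memLp_forward {h : ℝ → ℂ} (hh : MemLp h 2 ν) : MemLp (forward h) 2 ν :=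
  (isSubstochastic_expKernel.swap.memLp_integral hh).1.neg

/-- Two solutions differ by `C exp (-z)`, which has modulus at least `|C|` on `(-∞, 0)` and is
therefore not square integrable unless `C = 0`. Square integrability replaces a boundary condition.
-/
theorem eqOn_forward {w h : ℝ → ℂ} (hw : HasACDerivOn w (fun z => -w z - h z) (Iio 0))
    (hw2 : MemLp w 2 ν) (hh : MemLp h 2 ν) : ∀ z < 0, w z = forward h z := by
  have h1 := hw.add ((hasACDerivOn_forward hh).smul (-1))
  obtain ⟨C, hC⟩ := HasACDerivOn.eq_exp (α := -1) (h1.congr (fun _ _ => rfl)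
    (Eventually.of_forall fun z => by simp; ring))
  have hC0 : C = 0 := by
    have h2 : MemLp (fun _ : ℝ => C) 2 ν := by
      refine (hw2.add ((memLp_forward hh).const_smul (-1 : ℂ))).mono aestronglyMeasurable_const ?_
      filter_upwards [ae_restrict_mem measurableSet_Iio] with z hz
      rw [hC z hz, norm_mul, Complex.norm_real, Real.norm_of_nonneg (Real.exp_pos _).le]
      exact le_mul_of_one_le_left (norm_nonneg _)
        (Real.one_le_exp (by have : z < 0 := hz; linarith))
    rw [memLp_const_iff two_ne_zero ENNReal.ofNat_ne_top] at h2
    simpa using h2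
  intro z hz
  have := hC z hz
  rw [hC0] at this
  simp at this
  linear_combination this

/-- `backward` as an operator. -/
def backwardOp : L2Neg →L[ℂ] L2Neg := -isSubstochastic_expKernel.op

/-- `forward` as an operator. -/
def forwardOp : L2Neg →L[ℂ] L2Neg := -isSubstochastic_expKernel.swap.op

theorem coeFn_backwardOp (q : L2Neg) : backwardOp q =ᵐ[ν] backward q := by
  filter_upwards [Lp.coeFn_neg (isSubstochastic_expKernel.op q),
    isSubstochastic_expKernel.coeFn_op q] with z h1 h2
  rw [backwardOp, neg_apply, h1, Pi.neg_apply, h2, backward]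

theorem coeFn_forwardOp (q : L2Neg) : forwardOp q =ᵐ[ν] forward q := by
  filter_upwards [Lp.coeFn_neg (isSubstochastic_expKernel.swap.op q),
    isSubstochastic_expKernel.swap.coeFn_op q] with z h1 h2
  rw [forwardOp, neg_apply, h1, Pi.neg_apply, h2, forward]

/-- Because of this duality, applying `forwardOp` to an equation is the same as testing it against
every `backwardOp q`. -/
theorem inner_forwardOp_left (h q : L2Neg) : ⟪forwardOp h, q⟫_ℂ = ⟪h, backwardOp q⟫_ℂ := by
  rw [forwardOp, backwardOp, neg_apply, neg_apply,
    inner_neg_left, inner_neg_right, isSubstochastic_expKernel.swap.inner_op_left]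

theorem backward_congr {q q' : ℝ → ℂ} (h : q =ᵐ[ν] q') : backward q = backward q' := by
  funext z
  rw [backward, backward]
  congr 1
  refine integral_congr_ae ?_
  filter_upwards [h] with t ht
  rw [ht]

theorem integrable_inner_of_memLp {p q : ℝ → ℂ} (hp : MemLp p 2 ν) (hq : MemLp q 2 ν) :
    Integrable (fun z => ⟪p z, q z⟫_ℝ) ν := by
  have : Integrable (fun z => ((starRingEnd ℂ) (p z) * q z).re) ν :=
    (MemLp.integrable_mul hp.star hq).re
  refine this.congr (Eventually.of_forall fun z => ?_)
  simp [Complex.inner, mul_comm]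

/-- An `H¹` function vanishes at `-∞`. -/
theorem tendsto_atBot_zero_of_memLp {P P₁ : ℝ → ℂ} (h : ∀ z < 0, HasDerivAt P (P₁ z) z)
    (hP : MemLp P 2 ν) (hP₁ : MemLp P₁ 2 ν) : Tendsto P atBot (𝓝 0) := by
  have hsub : Iic (-1 : ℝ) ⊆ Iio 0 := Iic_subset_Iio.2 (by norm_num)
  have h1 : Tendsto (fun z => ‖P z‖ ^ 2) atBot (𝓝 0) := by
    refine tendsto_zero_of_hasDerivAt_of_integrableOn_Iic (a := -1)
      (f' := fun z => 2 * ⟪P z, P₁ z⟫_ℝ) (fun z hz => (h z (hsub hz)).norm_sq) ?_ ?_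
    · exact IntegrableOn.mono_set ((integrable_inner_of_memLp hP hP₁).const_mul 2) hsub
    · exact IntegrableOn.mono_set ((memLp_two_iff_integrable_sq_norm hP.1).1 hP) hsub
  rw [tendsto_zero_iff_norm_tendsto_zero]
  simpa using h1.sqrt

/-! ### Multiplication operators -/

/-- Multiplication by a bounded real function. -/
def mulOp (m : ℝ → ℝ) (hm : MemLp (fun z => (m z : ℂ)) ∞ ν) : L2Neg →L[ℂ] L2Neg :=
  (ContinuousLinearMap.mul ℂ ℂ).holderL ν ∞ 2 2 (hm.toLp _)

theorem coeFn_mulOp {m : ℝ → ℝ} (hm : MemLp (fun z => (m z : ℂ)) ∞ ν) (f : L2Neg) :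
    mulOp m hm f =ᵐ[ν] fun z => (m z : ℂ) * f z := by
  filter_upwards [(ContinuousLinearMap.mul ℂ ℂ).coeFn_holder (r := 2) (hm.toLp _) f,
    hm.coeFn_toLp] with z h1 h2
  have : (mulOp m hm f) z = _ := h1
  rw [this, h2]
  rfl

theorem memLp_ofReal_mul {m : ℝ → ℝ} (hm : MemLp (fun z => (m z : ℂ)) ∞ ν) {f : ℝ → ℂ}
    (hf : MemLp f 2 ν) : MemLp (fun z => (m z : ℂ) * f z) 2 ν :=
  hf.mul hm

theorem ae_neg_and_ne (s : ℝ) : ∀ᵐ z ∂ν, z < 0 ∧ z ≠ s := by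
  filter_upwards [ae_restrict_mem measurableSet_Iio, ae_restrict_of_ae (Measure.ae_ne volume s)]
    with z h1 h2 using ⟨h1, h2⟩

theorem memLp_top_of_continuousOn {s M : ℝ} {m : ℝ → ℝ} (hm : ContinuousOn m (Iio 0 \ {s}))
    (hM : ∀ z < 0, z ≠ s → |m z| ≤ M) : MemLp (fun z => (m z : ℂ)) ∞ ν := by
  have hr : ν = volume.restrict (Iio 0 \ {s}) :=
    Measure.restrict_congr_set (sdiff_null_ae_eq_self (measure_singleton s)).symm
  refine memLp_top_of_bound (C := M) ?_ ?_
  · rw [hr]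
    exact (Complex.continuous_ofReal.comp_continuousOn hm).aestronglyMeasurable
      (measurableSet_Iio.diff (measurableSet_singleton s))
  · filter_upwards [ae_neg_and_ne s] with z hz
    rw [Complex.norm_real]
    exact hM z hz.1 hz.2

/-! ### Second-order operators whose leading coefficient has a kink -/

/-- The data of a dissipative operator `p ↦ (d p)'' + c p' + r p` on `(-∞, 0)`, whose coefficient
`d`, with derivatives `d₁` and `d₂` off `s`, may have a convex kink at `s`. -/
structure IsDissipative (s : ℝ) (d d₁ d₂ r : ℝ → ℝ) : Prop where
  neg : s < 0
  hasDerivAt : ∀ z < 0, z ≠ s → HasDerivAt d (d₁ z) z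
  hasDerivAt_deriv : ∀ z < 0, z ≠ s → HasDerivAt d₁ (d₂ z) z
  continuousAt : ContinuousAt d s
  continuousOn_two : ContinuousOn d₂ (Iio 0 \ {s})
  continuousOn_pot : ContinuousOn r (Iio 0 \ {s})
  bounded : ∃ M, ∀ z < 0, z ≠ s → |d z| ≤ M ∧ |d₁ z| ≤ M ∧ |d₂ z| ≤ M ∧ |r z| ≤ M
  pos : ∃ m > 0, ∀ z < 0, m ≤ d z
  stable : ∃ δ > 0, ∀ z < 0, z ≠ s → 1 / 2 * d₂ z + r z ≤ -δ
  kink : ∃ jl jr, Tendsto d₁ (𝓝[<] s) (𝓝 jl) ∧ Tendsto d₁ (𝓝[>] s) (𝓝 jr) ∧ jl ≤ jr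

namespace IsDissipative

variable {s : ℝ} {d d₁ d₂ r : ℝ → ℝ}

theorem continuousOn (h : IsDissipative s d d₁ d₂ r) : ContinuousOn d (Iio 0) := by
  intro z hz
  by_cases hs : z = s
  · exact hs ▸ h.continuousAt.continuousWithinAt
  · exact (h.hasDerivAt z hz hs).continuousAt.continuousWithinAt

theorem continuousOn_one (h : IsDissipative s d d₁ d₂ r) : ContinuousOn d₁ (Iio 0 \ {s}) :=
  fun z hz => (h.hasDerivAt_deriv z hz.1 hz.2).continuousAt.continuousWithinAt

theorem memLp_coeff (h : IsDissipative s d d₁ d₂ r) : MemLp (fun z => (d z : ℂ)) ∞ ν := by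
  obtain ⟨M, hM⟩ := h.bounded
  exact memLp_top_of_continuousOn (h.continuousOn.mono sdiff_subset) fun z hz hs => (hM z hz hs).1

theorem memLp_drift (h : IsDissipative s d d₁ d₂ r) (c : ℝ) :
    MemLp (fun z => ((d₁ z + c : ℝ) : ℂ)) ∞ ν := by
  obtain ⟨M, hM⟩ := h.bounded
  exact memLp_top_of_continuousOn (s := s) (M := M + |c|)
    (h.continuousOn_one.add continuousOn_const) fun z hz hs => (abs_add_le _ _).trans (by linarith [(hM z hz hs).2.1])

theorem memLp_pot (h : IsDissipative s d d₁ d₂ r) :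
    MemLp (fun z => ((d₂ z + r z : ℝ) : ℂ)) ∞ ν := by
  obtain ⟨M, hM⟩ := h.bounded
  exact memLp_top_of_continuousOn (s := s) (M := M + M) (h.continuousOn_two.add h.continuousOn_pot)
    fun z hz hs => (abs_add_le _ _).trans (by linarith [(hM z hz hs).2.2.1, (hM z hz hs).2.2.2])

theorem memLp_inv (h : IsDissipative s d d₁ d₂ r) :
    MemLp (fun z => (((d z)⁻¹ : ℝ) : ℂ)) ∞ ν := by
  obtain ⟨m, hm, hmd⟩ := h.pos
  refine memLp_top_of_continuousOn (s := s) (M := m⁻¹)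
    ((h.continuousOn.mono sdiff_subset).inv₀ fun z hz => (hm.trans_le (hmd z hz.1)).ne') ?_
  intro z hz _
  rw [abs_of_pos (inv_pos.2 (hm.trans_le (hmd z hz)))]
  exact inv_anti₀ hm (hmd z hz)

theorem hasDerivAt_inv (h : IsDissipative s d d₁ d₂ r) {z : ℝ} (hz : z < 0) (hs : z ≠ s) :
    HasDerivAt (fun y => (d y)⁻¹) (-d₁ z / d z ^ 2) z := by
  obtain ⟨m, hm, hmd⟩ := h.pos
  exact (h.hasDerivAt z hz hs).inv (hm.trans_le (hmd z hz)).ne'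

theorem continuousOn_deriv_inv (h : IsDissipative s d d₁ d₂ r) :
    ContinuousOn (fun z => -d₁ z / d z ^ 2) (Iio 0 \ {s}) := by
  obtain ⟨m, hm, hmd⟩ := h.pos
  exact h.continuousOn_one.neg.div ((h.continuousOn.mono sdiff_subset).pow 2) fun z hz =>
    (pow_pos (hm.trans_le (hmd z hz.1)) 2).ne'

theorem memLp_deriv_inv (h : IsDissipative s d d₁ d₂ r) :
    MemLp (fun z => ((-d₁ z / d z ^ 2 : ℝ) : ℂ)) ∞ ν := by
  obtain ⟨m, hm, hmd⟩ := h.pos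
  obtain ⟨M, hM⟩ := h.bounded
  refine memLp_top_of_continuousOn (s := s) (M := M / m ^ 2) h.continuousOn_deriv_inv ?_
  intro z hz hs
  have hd := hmd z hz
  rw [abs_div, abs_neg, abs_of_pos (pow_pos (hm.trans_le hd) 2)]
  gcongr
  · exact (abs_nonneg _).trans (hM z hz hs).2.1
  · exact (hM z hz hs).2.1

/-! ### Dissipativity -/

/-- The integrand is `½ A' + (½ d₂ + r) |P|²` with `A = (d₁ + c) |P|²`. The jump of `A` at the kink
is the only boundary contribution that survives, and convexity `jl ≤ jr` gives it the right sign. -/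
theorem integral_le (h : IsDissipative s d d₁ d₂ r) (c : ℝ) {δ : ℝ}
    (hδ : ∀ z < 0, z ≠ s → 1 / 2 * d₂ z + r z ≤ -δ) {P P₁ : ℝ → ℂ}
    (hP : ∀ z < 0, HasDerivAt P (P₁ z) z) (hP2 : MemLp P 2 ν) (hP12 : MemLp P₁ 2 ν)
    (h0 : Tendsto P (𝓝[<] 0) (𝓝 0)) :
    ∫ z, ((d₁ z + c) * ⟪P z, P₁ z⟫_ℝ + (d₂ z + r z) * ‖P z‖ ^ 2) ∂ν ≤ -δ * ∫ z, ‖P z‖ ^ 2 ∂ν := by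
  obtain ⟨M, hM⟩ := h.bounded
  obtain ⟨jl, jr, hjl, hjr, hj⟩ := h.kink
  have hs := h.neg
  set A : ℝ → ℝ := fun z => (d₁ z + c) * ‖P z‖ ^ 2
  set A' : ℝ → ℝ := fun z => d₂ z * ‖P z‖ ^ 2 + (d₁ z + c) * (2 * ⟪P z, P₁ z⟫_ℝ)
  have hA : ∀ z < 0, z ≠ s → HasDerivAt A (A' z) z := fun z hz hzs =>
    ((h.hasDerivAt_deriv z hz hzs).add_const c).mul (hP z hz).norm_sq
  have hbdd : ∀ {m g : ℝ → ℝ}, MemLp (fun z => (m z : ℂ)) ∞ ν → Integrable g ν →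
      Integrable (fun z => m z * g z) ν := by
    intro m g hm hg
    have hm' : MemLp m ∞ ν := hm.re
    exact hg.mul_of_top_right hm'
  have hn : Integrable (fun z => ‖P z‖ ^ 2) ν := (memLp_two_iff_integrable_sq_norm hP2.1).1 hP2
  have hi : Integrable (fun z => ⟪P z, P₁ z⟫_ℝ) ν := integrable_inner_of_memLp hP2 hP12
  have hd2 : MemLp (fun z => (d₂ z : ℂ)) ∞ ν :=
    memLp_top_of_continuousOn h.continuousOn_two fun z hz hs => (hM z hz hs).2.2.1
  have hr : MemLp (fun z => (r z : ℂ)) ∞ ν :=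
    memLp_top_of_continuousOn h.continuousOn_pot fun z hz hs => (hM z hz hs).2.2.2
  have hA'int : Integrable A' ν := (hbdd hd2 hn).add (hbdd (h.memLp_drift c) (hi.const_mul 2))
  have hA'on : IntegrableOn A' (Iic 0) := by
    rw [IntegrableOn, ← restrict_Iio_eq_restrict_Iic]; exact hA'int
  have hnorm0 : Tendsto (fun z => ‖P z‖ ^ 2) (𝓝[<] 0) (𝓝 0) := by simpa using h0.norm.pow 2
  have hnormbot : Tendsto (fun z => ‖P z‖ ^ 2) atBot (𝓝 0) := by
    simpa using (tendsto_atBot_zero_of_memLp hP hP2 hP12).norm.pow 2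
  have hAlim : ∀ l : Filter ℝ, (∀ᶠ z in l, z < 0 ∧ z ≠ s) →
      Tendsto (fun z => ‖P z‖ ^ 2) l (𝓝 0) → Tendsto A l (𝓝 0) := by
    intro l hl ht
    refine squeeze_zero_norm' (a := fun z => (M + |c|) * ‖P z‖ ^ 2) ?_
      (by simpa using ht.const_mul (M + |c|))
    filter_upwards [hl] with z hz
    rw [Real.norm_eq_abs, abs_mul, abs_of_nonneg (sq_nonneg ‖P z‖)]
    gcongr
    exact (abs_add_le _ _).trans (by linarith [(hM z hz.1 hz.2).2.1])
  have hPs : Tendsto (fun z => ‖P z‖ ^ 2) (𝓝 s) (𝓝 (‖P s‖ ^ 2)) :=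
    ((hP s hs).continuousAt.norm.pow 2)
  have hleft : ∫ z in Iic s, A' z = (jl + c) * ‖P s‖ ^ 2 := by
    have h1 : Tendsto A (𝓝[<] s) (𝓝 ((jl + c) * ‖P s‖ ^ 2)) :=
      (hjl.add_const c).mul (hPs.mono_left nhdsWithin_le_nhds)
    -- The one-sided fundamental theorem needs continuity from the left at `s`; `A` is redefined
    -- there by its left limit because `d₁` may jump.
    have h2 := integral_Iic_of_hasDerivAt_of_tendsto (a := s) (m := 0) (f' := A')
      (f := Function.update A s ((jl + c) * ‖P s‖ ^ 2)) ?_ ?_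
      (hA'on.mono_set (Iic_subset_Iic.2 hs.le)) ?_
    · simpa using h2
    · rw [continuousWithinAt_update_same, Iic_sdiff_right]
      exact h1
    · intro z hz
      refine (hA z (lt_trans hz hs) (ne_of_lt hz)).congr_of_eventuallyEq ?_
      filter_upwards [isOpen_ne.mem_nhds (ne_of_lt hz)] with y hy
      rw [Function.update_of_ne hy]
    · refine (hAlim atBot ?_ hnormbot).congr' ?_
      · filter_upwards [Iio_mem_atBot s] with z hz using ⟨lt_trans hz hs, ne_of_lt hz⟩
      · filter_upwards [Iio_mem_atBot s] with z hz
        rw [Function.update_of_ne (ne_of_lt hz)]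
  have hright : ∫ z in s..0, A' z = 0 - (jr + c) * ‖P s‖ ^ 2 := by
    refine intervalIntegral.integral_eq_sub_of_hasDerivAt_of_tendsto hs
      (fun z hz => hA z hz.2 (ne_of_gt hz.1)) ?_
      ((hjr.add_const c).mul (hPs.mono_left nhdsWithin_le_nhds)) (hAlim _ ?_ hnorm0)
    · rw [intervalIntegrable_iff_integrableOn_Ioc_of_le hs.le]
      exact hA'on.mono_set fun z hz => hz.2
    · filter_upwards [Ioo_mem_nhdsLT hs] with z hz using ⟨hz.2, ne_of_gt hz.1⟩
  -- The two sides add up to `(jl - jr) |P(s)|²`; `c` cancels because `P` is continuous at `s`.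
  have htot : ∫ z, A' z ∂ν ≤ 0 := by
    rw [restrict_Iio_eq_restrict_Iic, ← Iic_union_Ioc_eq_Iic hs.le,
      setIntegral_union (Iic_disjoint_Ioc le_rfl) measurableSet_Ioc
        (hA'on.mono_set (Iic_subset_Iic.2 hs.le)) (hA'on.mono_set fun z hz => hz.2),
      ← intervalIntegral.integral_of_le hs.le, hleft, hright]
    nlinarith [sq_nonneg ‖P s‖]
  calc ∫ z, ((d₁ z + c) * ⟪P z, P₁ z⟫_ℝ + (d₂ z + r z) * ‖P z‖ ^ 2) ∂ν
      ≤ ∫ z, (1 / 2 * A' z + -δ * ‖P z‖ ^ 2) ∂ν := by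
        refine integral_mono_ae ((hbdd (h.memLp_drift c) hi).add (hbdd h.memLp_pot hn))
          ((hA'int.const_mul _).add (hn.const_mul _)) ?_
        filter_upwards [ae_neg_and_ne s] with z hz
        simp only [A']
        nlinarith [mul_le_mul_of_nonneg_right (hδ z hz.1 hz.2) (sq_nonneg ‖P z‖)]
    _ = 1 / 2 * ∫ z, A' z ∂ν + -δ * ∫ z, ‖P z‖ ^ 2 ∂ν := by
        rw [integral_add (hA'int.const_mul _) (hn.const_mul _), integral_const_mul,
          integral_const_mul]
    _ ≤ _ := by linarith

end IsDissipative

theorem re_inner_eq_integral (p f : L2Neg) : (⟪p, f⟫_ℂ).re = ∫ z, ⟪p z, f z⟫_ℝ ∂ν := by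
  rw [L2.inner_def]
  exact (integral_re (𝕜 := ℂ) (L2.integrable_inner (𝕜 := ℂ) p f)).symm

theorem norm_sq_eq_integral (p : L2Neg) : ‖p‖ ^ 2 = ∫ z, ‖p z‖ ^ 2 ∂ν := by
  have h := re_inner_eq_integral p p
  rw [inner_self_eq_norm_sq_to_K] at h
  simp only [real_inner_self_eq_norm_sq] at h
  rw [← h]
  norm_cast

theorem real_inner_ofReal_mul (x y : ℂ) (m : ℝ) : ⟪x, (m : ℂ) * y⟫_ℝ = m * ⟪x, y⟫_ℝ := by
  rw [← Complex.real_smul, real_inner_smul_right]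

theorem dense_toLp_continuous :
    Dense {q : L2Neg | ∃ g : ℝ → ℂ, Continuous g ∧ q =ᵐ[ν] g} := by
  intro q
  rw [Metric.mem_closure_iff]
  intro ε hε
  obtain ⟨g, -, hg, hc, hm⟩ := (Lp.memLp q).exists_hasCompactSupport_eLpNorm_sub_le
    ENNReal.ofNat_ne_top (ε := ENNReal.ofReal (ε / 2)) (by simpa using hε)
  refine ⟨hm.toLp g, ⟨g, hc, hm.coeFn_toLp⟩, ?_⟩
  rw [dist_eq_norm, Lp.norm_def, eLpNorm_congr_ae (g := ⇑q - g)]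
  · exact (ENNReal.toReal_le_of_le_ofReal (by positivity) hg).trans_lt (by linarith)
  · filter_upwards [Lp.coeFn_sub q (hm.toLp g), hm.coeFn_toLp] with z h1 h2
    rw [h1, Pi.sub_apply, h2, Pi.sub_apply]

/-! ### The variational form and its coercivity -/

/-- `p'` in terms of `q = p' - p`. -/
def derivOp : L2Neg →L[ℂ] L2Neg := backwardOp + 1

theorem derivOp_apply (q : L2Neg) : derivOp q = backwardOp q + q := rfl

theorem coeFn_derivOp (q : L2Neg) : derivOp q =ᵐ[ν] fun z => backward q z + q z := by
  filter_upwards [Lp.coeFn_add (backwardOp q) q, coeFn_backwardOp q] with z h1 h2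
  rw [derivOp_apply, h1, Pi.add_apply, h2]

namespace IsDissipative

variable {s : ℝ} {d d₁ d₂ r : ℝ → ℝ}

/-- `d p'` in terms of `q = p' - p`. -/
def flux (h : IsDissipative s d d₁ d₂ r) : L2Neg →L[ℂ] L2Neg :=
  mulOp d h.memLp_coeff ∘L derivOp

/-- `(d' + c) p' + (d'' + r) p` in terms of `q = p' - p`. -/
def lowerOrder (h : IsDissipative s d d₁ d₂ r) (c : ℝ) : L2Neg →L[ℂ] L2Neg :=
  mulOp (fun z => d₁ z + c) (h.memLp_drift c) ∘L derivOp +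
    mulOp (fun z => d₂ z + r z) h.memLp_pot ∘L backwardOp

theorem coeFn_flux (h : IsDissipative s d d₁ d₂ r) (q : L2Neg) :
    h.flux q =ᵐ[ν] fun z => (d z : ℂ) * (backward q z + q z) := by
  filter_upwards [coeFn_mulOp h.memLp_coeff (derivOp q), coeFn_derivOp q] with z h1 h2
  rw [flux, ContinuousLinearMap.comp_apply, h1, h2]

theorem coeFn_lowerOrder (h : IsDissipative s d d₁ d₂ r) (c : ℝ) (q : L2Neg) :
    h.lowerOrder c q =ᵐ[ν] fun z => ((d₁ z + c : ℝ) : ℂ) * (backward q z + q z) +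
      ((d₂ z + r z : ℝ) : ℂ) * backward q z := by
  filter_upwards [coeFn_mulOp (h.memLp_drift c) (derivOp q), coeFn_derivOp q,
    coeFn_mulOp h.memLp_pot (backwardOp q), coeFn_backwardOp q,
    Lp.coeFn_add (mulOp (fun z => d₁ z + c) (h.memLp_drift c) (derivOp q))
      (mulOp (fun z => d₂ z + r z) h.memLp_pot (backwardOp q))] with z h1 h2 h3 h4 h5
  rw [lowerOrder, add_apply, ContinuousLinearMap.comp_apply, ContinuousLinearMap.comp_apply, h5,
    Pi.add_apply, h1, h2, h3, h4]

theorem re_inner_lowerOrder_le (h : IsDissipative s d d₁ d₂ r) (c : ℝ) {δ : ℝ}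
    (hδ : ∀ z < 0, z ≠ s → 1 / 2 * d₂ z + r z ≤ -δ) (q : L2Neg) :
    (⟪backwardOp q, h.lowerOrder c q⟫_ℂ).re ≤ -δ * ‖backwardOp q‖ ^ 2 := by
  -- Both sides are continuous in `q`. For continuous `q` the function `p = backward q` is
  -- differentiable at every point of the half line, as the integral estimate requires.
  refine dense_toLp_continuous.induction ?_ (isClosed_le (by fun_prop) (by fun_prop)) q
  rintro q ⟨g, hg, hqg⟩
  have hgm : MemLp g 2 ν := (memLp_congr_ae hqg).1 (Lp.memLp q)
  have hac := hasACDerivOn_backward hgm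
  have hcont : ContinuousOn (fun z => backward g z + g z) (Iio 0) :=
    (hac.continuousOn isOpen_Iio).add hg.continuousOn
  have key := h.integral_le c hδ (fun z hz => hac.hasDerivAt isOpen_Iio hcont hz)
    (memLp_backward hgm) ((memLp_backward hgm).add hgm) (tendsto_backward_zero hgm)
  rw [re_inner_eq_integral, norm_sq_eq_integral]
  refine le_trans (le_of_eq (integral_congr_ae ?_)) (key.trans (le_of_eq ?_))
  · filter_upwards [h.coeFn_lowerOrder c q, coeFn_backwardOp q, hqg] with z h1 h2 h3
    rw [h1, h2, h3, backward_congr hqg, inner_add_right, real_inner_ofReal_mul,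
      real_inner_ofReal_mul, real_inner_self_eq_norm_sq]
  · congr 1
    refine integral_congr_ae ?_
    filter_upwards [coeFn_backwardOp q] with z h2
    rw [h2, backward_congr hqg]

theorem le_re_inner_flux (h : IsDissipative s d d₁ d₂ r) {m : ℝ} (hm : ∀ z < 0, m ≤ d z)
    (q : L2Neg) : m * ‖derivOp q‖ ^ 2 ≤ (⟪derivOp q, h.flux q⟫_ℂ).re := by
  rw [re_inner_eq_integral, norm_sq_eq_integral, ← integral_const_mul]
  have h0 : ∀ᵐ z ∂ν, ⟪derivOp q z, h.flux q z⟫_ℝ = d z * ‖derivOp q z‖ ^ 2 := by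
    filter_upwards [coeFn_mulOp h.memLp_coeff (derivOp q)] with z h1
    rw [flux, ContinuousLinearMap.comp_apply, h1, real_inner_ofReal_mul, real_inner_self_eq_norm_sq]
  refine integral_mono_ae ?_ (integrable_inner_of_memLp (Lp.memLp _) (Lp.memLp _)) ?_
  · exact ((memLp_two_iff_integrable_sq_norm (Lp.memLp (derivOp q)).1).1 (Lp.memLp _)).const_mul m
  · filter_upwards [h0, ae_restrict_mem measurableSet_Iio] with z h1 hz
    rw [h1]
    exact mul_le_mul_of_nonneg_right (hm z hz) (sq_nonneg _)

/-- The variational form of the operator, in terms of `q = p' - p`. -/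
def formOp (h : IsDissipative s d d₁ d₂ r) (c : ℝ) (μ : ℂ) : L2Neg →L[ℂ] L2Neg :=
  forwardOp ∘L (h.lowerOrder c - μ • backwardOp) - (forwardOp + 1) ∘L h.flux

theorem formOp_apply (h : IsDissipative s d d₁ d₂ r) (c : ℝ) (μ : ℂ) (q : L2Neg) :
    h.formOp c μ q = forwardOp (h.lowerOrder c q - μ • backwardOp q) -
      (forwardOp (h.flux q) + h.flux q) := rfl

/-- With `w = d p'`, the strong equation reads `w' = f + μ p - (lower order) = -w - h`, where `h` is
the argument of `forwardOp` on the right. The decaying solution is `w = forward h`, so the weak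
equation is an integrated equation for the flux. -/
theorem formOp_eq_iff (h : IsDissipative s d d₁ d₂ r) (c : ℝ) (μ : ℂ) (q f : L2Neg) :
    h.formOp c μ q = forwardOp f ↔
      h.flux q = forwardOp (h.lowerOrder c q - μ • backwardOp q - h.flux q - f) := by
  rw [formOp_apply]
  simp only [map_sub]
  constructor
  · intro e
    rw [← e]; abel
  · intro e
    nth_rewrite 2 [e]
    abel

theorem isUnit_formOp (h : IsDissipative s d d₁ d₂ r) (c : ℝ) {μ : ℂ} (hμ : 0 ≤ μ.re) :
    IsUnit (h.formOp c μ) := by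
  obtain ⟨m, hm, hmd⟩ := h.pos
  obtain ⟨δ, hδ, hst⟩ := h.stable
  -- The form is at most `-m ‖p'‖² - δ ‖p‖²`, and `q = p' - p` gives `‖q‖² ≤ 2 ‖p'‖² + 2 ‖p‖²`;
  -- hence the factor `1 / 2`.
  set κ : ℝ := min m δ / 2 with hκ
  have hκ0 : 0 < κ := by positivity
  -- Lax-Milgram: a bounded operator with `|⟨q, T q⟩| ≥ κ ‖q‖²` is invertible.
  refine ContinuousLinearMap.isUnit_of_forall_le_norm_inner_map _ (c := ⟨κ, hκ0.le⟩) hκ0 fun q => ?_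
  have e1 : ⟪q, h.formOp c μ q⟫_ℂ = ⟪backwardOp q, h.lowerOrder c q⟫_ℂ -
      μ * ⟪backwardOp q, backwardOp q⟫_ℂ - ⟪derivOp q, h.flux q⟫_ℂ := by
    have adj : ∀ f, ⟪q, forwardOp f⟫_ℂ = ⟪backwardOp q, f⟫_ℂ := fun f => by
      rw [← inner_conj_symm, inner_forwardOp_left, inner_conj_symm]
    rw [formOp_apply, inner_sub_right, inner_add_right, adj, adj, inner_sub_right, inner_smul_right,
      derivOp_apply, inner_add_left]
  have e2 : (μ * ⟪backwardOp q, backwardOp q⟫_ℂ).re = μ.re * ‖backwardOp q‖ ^ 2 := by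
    rw [inner_self_eq_norm_sq_to_K]
    norm_cast
    simp [-Complex.ofReal_pow]
  have h1 := h.re_inner_lowerOrder_le c hst q
  have h2 := h.le_re_inner_flux hmd q
  have h3 : (⟪q, h.formOp c μ q⟫_ℂ).re ≤ -(κ * ‖q‖ ^ 2) := by
    rw [e1, Complex.sub_re, Complex.sub_re, e2]
    have h4 : ‖q‖ ≤ ‖derivOp q‖ + ‖backwardOp q‖ := by
      have : q = derivOp q - backwardOp q := by rw [derivOp_apply]; abel
      calc ‖q‖ = ‖derivOp q - backwardOp q‖ := by rw [← this]
        _ ≤ _ := norm_sub_le _ _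
    have h5 : ‖q‖ ^ 2 ≤ 2 * ‖derivOp q‖ ^ 2 + 2 * ‖backwardOp q‖ ^ 2 := by
      nlinarith [sq_nonneg (‖derivOp q‖ - ‖backwardOp q‖), norm_nonneg q]
    have h6 : min m δ ≤ m := min_le_left _ _
    have h7 : min m δ ≤ δ := min_le_right _ _
    nlinarith [mul_le_mul_of_nonneg_left h5 hκ0.le, mul_nonneg hμ (sq_nonneg ‖backwardOp q‖),
      mul_le_mul_of_nonneg_right h6 (sq_nonneg ‖derivOp q‖),
      mul_le_mul_of_nonneg_right h7 (sq_nonneg ‖backwardOp q‖)]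
  have h8 := Complex.abs_re_le_norm ⟪q, h.formOp c μ q⟫_ℂ
  rw [norm_inner_symm] at h8
  change ‖q‖ ^ 2 * κ ≤ _
  have h9 := neg_le_of_abs_le h8
  linarith

end IsDissipative

/-! ### The resolvent -/

/-- `f = (d p)'' + c p' + r p` for an admissible `p`, with a shock at `s`. -/
def IsImage (s c : ℝ) (d r : ℝ → ℝ) (p f : L2Neg) : Prop :=
  ∃ P P₁ P₂ Q Q₁ : ℝ → ℂ,
    IsAdmissible s P P₁ P₂ ∧
    p =ᵐ[ν] P ∧
    (∀ z < 0, z ≠ s → HasDerivAt (fun y => (d y : ℂ) * P y) (Q z) z) ∧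
    HasACDerivOn Q Q₁ (Iio s) ∧
    HasACDerivOn Q Q₁ (Ioo s 0) ∧
    f =ᵐ[ν] fun z => Q₁ z + (c : ℂ) * P₁ z + (r z : ℂ) * P z

namespace IsDissipative

variable {s : ℝ} {d d₁ d₂ r : ℝ → ℝ}

/-- The right-hand side `h` of the equation `w' = -w - h` for the flux `w = d p'`. -/
def fluxSource (h : IsDissipative s d d₁ d₂ r) (c : ℝ) (μ : ℂ) (q f : L2Neg) : L2Neg :=
  h.lowerOrder c q - μ • backwardOp q - h.flux q - f

theorem coeFn_fluxSource (h : IsDissipative s d d₁ d₂ r) (c : ℝ) (μ : ℂ) (q f : L2Neg) :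
    h.fluxSource c μ q f =ᵐ[ν] fun z => ((d₁ z + c : ℝ) : ℂ) * (backward q z + q z) +
      ((d₂ z + r z : ℝ) : ℂ) * backward q z - μ * backward q z -
      (d z : ℂ) * (backward q z + q z) - f z := by
  filter_upwards [Lp.coeFn_sub (h.lowerOrder c q - μ • backwardOp q - h.flux q) f,
    Lp.coeFn_sub (h.lowerOrder c q - μ • backwardOp q) (h.flux q),
    Lp.coeFn_sub (h.lowerOrder c q) (μ • backwardOp q), Lp.coeFn_smul μ (backwardOp q),
    h.coeFn_lowerOrder c q, coeFn_backwardOp q, h.coeFn_flux q] with z e1 e2 e3 e4 e5 e6 e7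
  rw [fluxSource, e1, Pi.sub_apply, e2, Pi.sub_apply, e3, Pi.sub_apply, e4, Pi.smul_apply, e5, e6,
    e7, smul_eq_mul]

/-- Regularity of weak solutions. The flux `W = forward H` is absolutely continuous on the whole
half line, so `p' = W / d` is continuous even at the kink. The jump of `d₁` enters only `P₂` and
`Q`, which are needed on each side separately. -/
theorem isImage_of_formOp_eq (h : IsDissipative s d d₁ d₂ r) (c : ℝ) (μ : ℂ) (q f : L2Neg)
    (hq : h.formOp c μ q = forwardOp f) :
    IsImage s c d r (backwardOp q) (f + μ • backwardOp q) := by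
  obtain ⟨m, hm, hmd⟩ := h.pos
  have hd : ∀ z < 0, (d z : ℂ) ≠ 0 := fun z hz =>
    Complex.ofReal_ne_zero.2 (hm.trans_le (hmd z hz)).ne'
  have hsubl : Iio s ⊆ Iio 0 \ {s} := fun z hz => ⟨lt_trans hz h.neg, ne_of_lt hz⟩
  have hsubr : Ioo s 0 ⊆ Iio 0 \ {s} := fun z hz => ⟨hz.2, ne_of_gt hz.1⟩
  set H := h.fluxSource c μ q f with hH
  have hHm : MemLp H 2 ν := Lp.memLp H
  have hqm : MemLp q 2 ν := Lp.memLp q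
  set W := forward H with hW
  set P := backward q with hPdef
  have hWm : MemLp W 2 ν := memLp_forward hHm
  have hWac := hasACDerivOn_forward hHm
  have hPac := hasACDerivOn_backward hqm
  have hWeq : ∀ᵐ z ∂ν, W z = (d z : ℂ) * (P z + q z) := by
    filter_upwards [coeFn_forwardOp H, h.coeFn_flux q] with z e1 e2
    rw [hW, ← e1, hH, fluxSource, ← (h.formOp_eq_iff c μ q f).1 hq, e2]
  -- This is the continuous representative of `p' = p + q`; continuity upgrades the almost
  -- everywhere derivative to a classical one.
  set P₁ : ℝ → ℂ := fun z => (((d z)⁻¹ : ℝ) : ℂ) * W z with hP1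
  have hP1m : MemLp P₁ 2 ν := memLp_ofReal_mul h.memLp_inv hWm
  have hP1c : ContinuousOn P₁ (Iio 0) :=
    (Complex.continuous_ofReal.comp_continuousOn
      (h.continuousOn.inv₀ fun z hz => (hm.trans_le (hmd z hz)).ne')).mul
      (hWac.continuousOn isOpen_Iio)
  have hPac' : HasACDerivOn P P₁ (Iio 0) := by
    refine hPac.congr (fun _ _ => rfl) ?_
    filter_upwards [hWeq, ae_restrict_mem measurableSet_Iio] with z e1 hz
    have := hd z hz
    simp only [hP1]
    rw [e1, ← hPdef]
    push_cast
    field_simp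
  have hPd : ∀ z < 0, HasDerivAt P (P₁ z) z := fun z hz => hPac'.hasDerivAt isOpen_Iio hP1c hz
  have hdP1 : ∀ z < 0, (d z : ℂ) * P₁ z = W z := fun z hz => by
    have := hd z hz
    simp only [hP1]
    push_cast
    field_simp
  set P₂ : ℝ → ℂ := fun z => ((-d₁ z / d z ^ 2 : ℝ) : ℂ) * W z + (((d z)⁻¹ : ℝ) : ℂ) * (-W z - H z)
    with hP2
  set Q : ℝ → ℂ := (fun z => (d₁ z : ℂ) * P z) + W with hQ
  set Q₁ : ℝ → ℂ := (fun z => (d₂ z : ℂ) * P z + (d₁ z : ℂ) * P₁ z) + fun z => -W z - H z with hQ1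
  have hPm : MemLp P 2 ν := memLp_backward hqm
  have side : ∀ J : Set ℝ, OrdConnected J → J ⊆ Iio 0 \ {s} →
      HasACDerivOn P₁ P₂ J ∧ HasACDerivOn Q Q₁ J := by
    intro J _ hJ
    have hJ0 : J ⊆ Iio 0 := hJ.trans sdiff_subset
    constructor
    · exact (hWac.mono hJ0).ofReal_mul (fun z hz => h.hasDerivAt_inv (hJ hz).1 (hJ hz).2)
        (h.continuousOn_deriv_inv.mono hJ)
    · exact ((hPac'.mono hJ0).ofReal_mul (fun z hz => h.hasDerivAt_deriv z (hJ hz).1 (hJ hz).2)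
        (h.continuousOn_two.mono hJ)).add (hWac.mono hJ0)
  have hl := side (Iio s) ordConnected_Iio hsubl
  have hr := side (Ioo s 0) ordConnected_Ioo hsubr
  refine ⟨P, P₁, P₂, Q, Q₁, ⟨hPd, hP1c, hl.1, hr.1, hPm, hP1m, ?_, tendsto_backward_zero hqm,
    tendsto_atBot_zero_of_memLp hPd hPm hP1m⟩, coeFn_backwardOp q, ?_, hl.2, hr.2, ?_⟩
  · exact (memLp_ofReal_mul h.memLp_deriv_inv hWm).add
      (memLp_ofReal_mul h.memLp_inv (hWm.neg.sub hHm))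
  · intro z hz hzs
    refine ((h.hasDerivAt z hz hzs).ofReal_comp.mul (hPd z hz)).congr_deriv ?_
    rw [hdP1 z hz]
    rfl
  · filter_upwards [Lp.coeFn_add f (μ • backwardOp q), Lp.coeFn_smul μ (backwardOp q),
      coeFn_backwardOp q, h.coeFn_fluxSource c μ q f, hWeq, ae_restrict_mem measurableSet_Iio]
      with z e1 e2 e3 e4 e5 hz
    have e6 : P z + q z = P₁ z := by
      have := hdP1 z hz
      rw [e5] at this
      exact (mul_left_cancel₀ (hd z hz) this).symm
    rw [e1, Pi.add_apply, e2, Pi.smul_apply, e3, smul_eq_mul]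
    rw [← hH, ← hPdef, e6, hdP1 z hz] at e4
    simp only [hQ1, Pi.add_apply]
    rw [e4]
    push_cast
    ring

/-- The converse: an admissible `p` comes from `q = P₁ - P`. On each side of the shock `d p' = (d
p)' - d' p` solves the flux equation, and matching at `s` makes it a global solution. -/
theorem formOp_eq_of_isImage (h : IsDissipative s d d₁ d₂ r) (c : ℝ) (μ : ℂ) {p f : L2Neg}
    (hp : IsImage s c d r p f) :
    ∃ q, backwardOp q = p ∧ h.formOp c μ q = forwardOp (f - μ • p) := by
  obtain ⟨P, P₁, P₂, Q, Q₁, hP, hpP, hQ, hQl, hQr, hf⟩ := hp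
  have hsubl : Iio s ⊆ Iio 0 \ {s} := fun z hz => ⟨lt_trans hz h.neg, ne_of_lt hz⟩
  have hsubr : Ioo s 0 ⊆ Iio 0 \ {s} := fun z hz => ⟨hz.2, ne_of_gt hz.1⟩
  have hPac : HasACDerivOn P P₁ (Iio 0) := .of_hasDerivAt (fun z hz => hP.hasDerivAt z hz)
    hP.continuousOn
  have hqm : MemLp (P₁ - P) 2 ν := hP.memLp_one.sub hP.memLp
  set q : L2Neg := hqm.toLp _ with hqdef
  have hqae : q =ᵐ[ν] P₁ - P := hqm.coeFn_toLp
  have hback : ∀ z < 0, backward q z = P z := fun z hz => by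
    rw [backward_congr hqae, eqOn_backward hPac hP.front hqm z hz]
  have hqp : backwardOp q = p := by
    refine Lp.ext ?_
    filter_upwards [coeFn_backwardOp q, hpP, ae_restrict_mem measurableSet_Iio] with z e1 e2 hz
    rw [e1, e2, hback z hz]
  refine ⟨q, hqp, (h.formOp_eq_iff c μ q _).2 ?_⟩
  set H := h.fluxSource c μ q (f - μ • p) with hH
  change h.flux q = forwardOp H
  have hHm : MemLp H 2 ν := Lp.memLp H
  set W : ℝ → ℂ := fun z => (d z : ℂ) * P₁ z with hW
  have hWm : MemLp W 2 ν := memLp_ofReal_mul h.memLp_coeff hP.memLp_one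
  have hsource : ∀ᵐ z ∂ν, -W z - H z =
      Q₁ z + (-1 : ℂ) • ((d₂ z : ℂ) * P z + (d₁ z : ℂ) * P₁ z) := by
    filter_upwards [h.coeFn_fluxSource c μ q (f - μ • p), Lp.coeFn_sub f (μ • p),
      Lp.coeFn_smul μ p, hpP, hf, hqae, ae_restrict_mem measurableSet_Iio]
      with z e1 e2 e3 e4 e5 e6 hz
    rw [hH, e1, e2, Pi.sub_apply, e3, Pi.smul_apply, e4, e5, e6, hback z hz, Pi.sub_apply]
    simp only [hW, smul_eq_mul]
    push_cast
    ring
  have side : ∀ J : Set ℝ, OrdConnected J → J ⊆ Iio 0 \ {s} → HasACDerivOn Q Q₁ J →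
      HasACDerivOn W (fun z => -W z - H z) J := by
    intro J _ hJ hQJ
    have hJ0 : J ⊆ Iio 0 := hJ.trans sdiff_subset
    have h1 := hQJ.add (((hPac.mono hJ0).ofReal_mul
      (fun z hz => h.hasDerivAt_deriv z (hJ hz).1 (hJ hz).2)
      (h.continuousOn_two.mono hJ)).smul (-1))
    refine h1.congr (fun z hz => ?_) (ae_restrict_of_ae_restrict_of_subset hJ0 hsource)
    have h2 := (hQ z (hJ hz).1 (hJ hz).2).unique
      ((h.hasDerivAt z (hJ hz).1 (hJ hz).2).ofReal_comp.mul (hP.hasDerivAt z (hJ hz).1))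
    simp only [hW, Pi.add_apply, Pi.smul_apply, smul_eq_mul]
    rw [h2]
    ring
  -- `(d p)'` may jump at `s`, but `d p'` does not, since `d` and `p'` are continuous there. So the
  -- distributional derivative of `W` has no point mass at `s`.
  have hWac : HasACDerivOn W (fun z => -W z - H z) (Iio 0) := by
    refine HasACDerivOn.glue h.neg (side _ ordConnected_Iio hsubl hQl)
      (side _ ordConnected_Ioo hsubr hQr) ?_ ?_
    · exact (Complex.continuous_ofReal.continuousAt.comp h.continuousAt).mul
        (hP.continuousOn.continuousAt (isOpen_Iio.mem_nhds h.neg))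
    · intro x hx y hy
      exact intervalIntegrable_of_memLp (hWm.neg.sub hHm) (le_of_lt hx) (le_of_lt hy)
  have hWeq := eqOn_forward hWac hWm hHm
  refine Lp.ext ?_
  filter_upwards [coeFn_forwardOp H, h.coeFn_flux q, hqae, ae_restrict_mem measurableSet_Iio]
    with z e1 e2 e3 hz
  rw [e1, e2, ← hWeq z hz, e3, hback z hz, Pi.sub_apply, add_sub_cancel]

/-- `forwardOp` passes to the weak form, the inverse of `formOp` solves for `q`, and `backwardOp`
recovers `p`. The two directions of the weak-strong equivalence give the right and left inverse
properties. -/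
theorem exists_resolvent (h : IsDissipative s d d₁ d₂ r) (c : ℝ) {μ : ℂ} (hμ : 0 ≤ μ.re) :
    ∃ B : L2Neg →L[ℂ] L2Neg, (∀ f, IsImage s c d r (B f) (f + μ • B f)) ∧
      ∀ p f, IsImage s c d r p f → B (f - μ • p) = p := by
  obtain ⟨T, hT⟩ := h.isUnit_formOp c hμ
  have hTl : ∀ q, (↑T⁻¹ : L2Neg →L[ℂ] L2Neg) (h.formOp c μ q) = q := fun q => by
    rw [← hT, ← mul_apply_eq_comp, Units.inv_mul]
    rfl
  have hTr : ∀ q, h.formOp c μ ((↑T⁻¹ : L2Neg →L[ℂ] L2Neg) q) = q := fun q => by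
    rw [← hT, ← mul_apply_eq_comp, Units.mul_inv]
    rfl
  refine ⟨backwardOp ∘L (↑T⁻¹ : L2Neg →L[ℂ] L2Neg) ∘L forwardOp, fun f => ?_, fun p f hpf => ?_⟩
  · exact h.isImage_of_formOp_eq c μ _ f (hTr _)
  · obtain ⟨q, hq, hqf⟩ := h.formOp_eq_of_isImage c μ hpf
    rw [ContinuousLinearMap.comp_apply, ContinuousLinearMap.comp_apply, ← hqf, hTl, hq]

end IsDissipative

/-! ### The coefficients along the wave -/

/-- The values of the wave and their limits. -/
def waveRange (a b : ℝ) : Set ℝ := Icc 0 (shockLower a b) ∪ Icc (shockUpper a b) 1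

theorem isCompact_waveRange (a b : ℝ) : IsCompact (waveRange a b) :=
  isCompact_Icc.union isCompact_Icc

/-- `D(ū)_z` as a function of the value of `ū`. -/
def diffusivityZ (a b k u : ℝ) : ℝ := deriv (diffusivity a b) u * waveSlope a b k u

theorem diffusivityZ_eq (a b k u : ℝ) :
    diffusivityZ a b k u = (2 * u - a - b) * (k * kirchhoff a b u / diffusivity a b u) := by
  rw [diffusivityZ, (hasDerivAt_diffusivity a b u).deriv, waveSlope]

theorem contDiff_diffusivity (a b : ℝ) : ContDiff ℝ 2 (diffusivity a b) := by
  unfold diffusivity; fun_prop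

theorem contDiff_kirchhoff (a b : ℝ) : ContDiff ℝ 2 (kirchhoff a b) := by
  rw [show kirchhoff a b = _ from funext (kirchhoff_eq a b)]; fun_prop

theorem isOpen_diffusivity_ne (a b : ℝ) : IsOpen {u | diffusivity a b u ≠ 0} :=
  isOpen_ne.preimage (continuous_diffusivity a b)

theorem contDiffOn_waveSlope (a b k : ℝ) :
    ContDiffOn ℝ 2 (waveSlope a b k) {u | diffusivity a b u ≠ 0} :=
  (contDiff_const.mul (contDiff_kirchhoff a b)).contDiffOn.div
    (contDiff_diffusivity a b).contDiffOn fun _ hu => hu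

theorem contDiffOn_diffusivityZ (a b k : ℝ) :
    ContDiffOn ℝ 2 (diffusivityZ a b k) {u | diffusivity a b u ≠ 0} := by
  have h : deriv (diffusivity a b) = fun u => 2 * u - a - b :=
    funext fun u => (hasDerivAt_diffusivity a b u).deriv
  unfold diffusivityZ
  rw [h]
  exact (by fun_prop : ContDiff ℝ 2 fun u : ℝ => 2 * u - a - b).contDiffOn.mul
    (contDiffOn_waveSlope a b k)

theorem continuousOn_diffusivityZZ (a b k : ℝ) :
    ContinuousOn (diffusivityZZ a b k) {u | diffusivity a b u ≠ 0} :=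
  ((contDiffOn_diffusivityZ a b k).continuousOn_deriv_of_isOpen (isOpen_diffusivity_ne a b)
    (by norm_num)).mul (contDiffOn_waveSlope a b k).continuousOn

theorem continuousOn_deriv_reaction (a b k : ℝ) :
    ContinuousOn (deriv (reaction a b k)) {u | diffusivity a b u ≠ 0} := by
  refine ContDiffOn.continuousOn_deriv_of_isOpen (n := 2) ?_ (isOpen_diffusivity_ne a b)
    (by norm_num)
  unfold reaction
  exact ((contDiffOn_const.div (contDiff_diffusivity a b).contDiffOn fun _ hu => hu).add
    contDiffOn_const).mul (contDiff_kirchhoff a b).contDiffOn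

theorem diffusivity_pos_of_mem_waveRange {a b u : ℝ} (hab : a < b) (hneg : b < (a + 2) / 3)
    (hpos : b < a * (2 + √3))
    (hu : u ∈ waveRange a b) :
    0 < diffusivity a b u := by
  obtain ⟨-, hl, hr, -, -, -⟩ := shock_bounds hab hneg hpos
  rcases hu with hu | hu
  · exact mul_pos_of_neg_of_neg (by linarith [hu.2]) (by linarith [hu.2])
  · exact mul_pos (by linarith [hu.1]) (by linarith [hu.1])

theorem wave_shockPos {a b k : ℝ} (hab : a < b) (hneg : b < (a + 2) / 3)
    (hpos : b < a * (2 + √3)) (hk : 0 < k) :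
    wave a b k (shockPos a b k) = shockLower a b := by
  obtain ⟨h0, hl, -, -, -, -⟩ := shock_bounds hab hneg hpos
  obtain ⟨-, hs⟩ := shockPos_spec hab hneg hpos hk
  rw [wave, if_neg (lt_irrefl _), hs]
  have hex : ∃ u ∈ Icc 0 (shockLower a b), kirchhoff a b u = kirchhoff a b (shockLower a b) :=
    ⟨_, right_mem_Icc.2 h0.le, rfl⟩
  obtain ⟨hm, he⟩ := Function.invFunOn_pos hex
  exact (strictMonoOn_kirchhoff_left hab).injOn (hm.2.trans hl.le) hl.le he

theorem wave_mem_waveRange {a b k z : ℝ} (hab : a < b) (hneg : b < (a + 2) / 3)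
    (hpos : b < a * (2 + √3)) (hk : 0 < k)
    (hz : z < 0) : wave a b k z ∈ waveRange a b := by
  obtain ⟨h0, -, -, -, -, -⟩ := shock_bounds hab hneg hpos
  rcases lt_trichotomy z (shockPos a b k) with h | h | h
  · exact Or.inr (Ioo_subset_Icc_self (wave_left hab hneg hpos hk h).1)
  · rw [h, wave_shockPos hab hneg hpos hk]
    exact Or.inl (right_mem_Icc.2 h0.le)
  · exact Or.inl (Ioo_subset_Icc_self (wave_right hab hneg hpos hk h hz).1)

theorem tendsto_kirchhoff_wave {a b k : ℝ} (hab : a < b) (hneg : b < (a + 2) / 3)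
    (hpos : b < a * (2 + √3)) (hk : 0 < k) :
    Tendsto (fun z => kirchhoff a b 0 * Real.exp (k * z)) (𝓝 (shockPos a b k))
      (𝓝 (kirchhoff a b (shockLower a b))) := by
  rw [← (shockPos_spec hab hneg hpos hk).2]
  exact Continuous.tendsto (by fun_prop) _

/-- `Φ(ū)` tends to `Φ(u_l) = Φ(u_r)` at the shock, and strict monotonicity of `Φ` on the right
branch turns this into convergence of `ū` to `u_r`. -/
theorem tendsto_wave_left {a b k : ℝ} (hab : a < b) (hneg : b < (a + 2) / 3)
    (hpos : b < a * (2 + √3)) (hk : 0 < k) :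
    Tendsto (wave a b k) (𝓝[<] (shockPos a b k)) (𝓝 (shockUpper a b)) := by
  obtain ⟨-, -, hr, hr1, -, -⟩ := shock_bounds hab hneg hpos
  have hΦ := ((shock_iff hab _ _).2 ⟨rfl, rfl⟩).2.1
  have ht := (tendsto_kirchhoff_wave hab hneg hpos hk).mono_left
    (nhdsWithin_le_nhds (s := Iio (shockPos a b k)))
  refine tendsto_order.2 ⟨fun v hv => ?_, fun v hv => ?_⟩
  · filter_upwards [self_mem_nhdsWithin] with z hz
    exact hv.trans (wave_left hab hneg hpos hk hz).1.1
  · have hlt : kirchhoff a b (shockLower a b) < kirchhoff a b v := by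
      rw [hΦ]
      exact strictMonoOn_kirchhoff_right hab hr.le (hr.trans hv).le hv
    filter_upwards [self_mem_nhdsWithin, ht.eventually_lt_const hlt] with z hz hz'
    obtain ⟨h1, h2⟩ := wave_left hab hneg hpos hk hz
    rw [← h2] at hz'
    exact ((strictMonoOn_kirchhoff_right hab).lt_iff_lt (hr.trans h1.1).le (hr.trans hv).le).1 hz'

theorem tendsto_wave_right {a b k : ℝ} (hab : a < b) (hneg : b < (a + 2) / 3)
    (hpos : b < a * (2 + √3)) (hk : 0 < k) :
    Tendsto (wave a b k) (𝓝[>] (shockPos a b k)) (𝓝 (shockLower a b)) := by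
  obtain ⟨-, hl, -, -, -, -⟩ := shock_bounds hab hneg hpos
  have hs := (shockPos_spec hab hneg hpos hk).1
  have ht := (tendsto_kirchhoff_wave hab hneg hpos hk).mono_left
    (nhdsWithin_le_nhds (s := Ioi (shockPos a b k)))
  refine tendsto_order.2 ⟨fun v hv => ?_, fun v hv => ?_⟩
  · have hlt : kirchhoff a b v < kirchhoff a b (shockLower a b) :=
      strictMonoOn_kirchhoff_left hab (hv.trans hl).le hl.le hv
    filter_upwards [Ioo_mem_nhdsGT hs, ht.eventually_const_lt hlt] with z hz hz'
    obtain ⟨h1, h2⟩ := wave_right hab hneg hpos hk hz.1 hz.2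
    rw [← h2] at hz'
    exact ((strictMonoOn_kirchhoff_left hab).lt_iff_lt (hv.trans hl).le (h1.2.trans hl).le).1 hz'
  · filter_upwards [Ioo_mem_nhdsGT hs] with z hz
    exact (wave_right hab hneg hpos hk hz.1 hz.2).1.2.trans hv

/-- `D(ū)_z` jumps upwards at the shock. -/
theorem diffusivityZ_shock_le {a b k : ℝ} (hab : a < b) (hneg : b < (a + 2) / 3)
    (hpos : b < a * (2 + √3)) (hk : 0 < k) :
    diffusivityZ a b k (shockUpper a b) ≤ diffusivityZ a b k (shockLower a b) := by
  obtain ⟨h0, hl, hr, hr1, h1, h2⟩ := shock_bounds hab hneg hpos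
  obtain ⟨hlr, hΦ, hD⟩ := (shock_iff hab _ _).2 ⟨rfl, rfl⟩
  rw [diffusivityZ_eq, diffusivityZ_eq, ← hΦ, ← hD]
  have hDl : 0 < diffusivity a b (shockLower a b) :=
    diffusivity_pos_of_mem_waveRange hab hneg hpos (Or.inl (right_mem_Icc.2 h0.le))
  have hq : k * kirchhoff a b (shockLower a b) / diffusivity a b (shockLower a b) < 0 :=
    div_neg_of_neg_of_pos (mul_neg_of_pos_of_neg hk h2) hDl
  -- `D'(u) = 2 u - a - b` is larger at `u_r`, and the common factor `k Φ / D` is negative because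
  -- `Φ(u_l) < 0`.
  exact mul_le_mul_of_nonpos_right (by linarith) hq.le

/-- Although `ū` jumps, `D(ū)` does not, because the shock satisfies `D(u_l) = D(u_r)`. -/
theorem continuousAt_diffusivity_wave {a b k : ℝ} (hab : a < b) (hneg : b < (a + 2) / 3)
    (hpos : b < a * (2 + √3)) (hk : 0 < k) :
    ContinuousAt (fun z => diffusivity a b (wave a b k z)) (shockPos a b k) := by
  have hD := ((shock_iff hab _ _).2 ⟨rfl, rfl⟩).2.2
  refine continuousAt_iff_continuous_left'_right'.2 ⟨?_, ?_⟩
  · rw [ContinuousWithinAt, wave_shockPos hab hneg hpos hk, hD]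
    exact ((continuous_diffusivity a b).tendsto _).comp (tendsto_wave_left hab hneg hpos hk)
  · rw [ContinuousWithinAt, wave_shockPos hab hneg hpos hk]
    exact ((continuous_diffusivity a b).tendsto _).comp (tendsto_wave_right hab hneg hpos hk)

/-- All coefficients are functions of `u` continuous on the compact set `waveRange`, where `D > 0`.
Compactness supplies the uniform bounds, and the properties of the shock supply the continuity of
`d` and its convex kink. -/
theorem isDissipative_wave {a b k : ℝ} (hab : a < b) (hneg : b < (a + 2) / 3)
    (hpos : b < a * (2 + √3)) (hk : 0 < k)
    (hstab : ∀ u ∈ waveRange a b,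
      1 / 2 * diffusivityZZ a b k u + deriv (reaction a b k) u < 0) :
    IsDissipative (shockPos a b k) (fun z => diffusivity a b (wave a b k z))
      (fun z => diffusivityZ a b k (wave a b k z)) (fun z => diffusivityZZ a b k (wave a b k z))
      (fun z => deriv (reaction a b k) (wave a b k z)) := by
  obtain ⟨h0, hl, hr, hr1, h1, h2⟩ := shock_bounds hab hneg hpos
  have hK := isCompact_waveRange a b
  have hne : (waveRange a b).Nonempty := ⟨0, Or.inl (left_mem_Icc.2 h0.le)⟩
  have hDpos : ∀ u ∈ waveRange a b, 0 < diffusivity a b u := fun u hu =>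
    diffusivity_pos_of_mem_waveRange hab hneg hpos hu
  have hKU : waveRange a b ⊆ {u | diffusivity a b u ≠ 0} := fun u hu => (hDpos u hu).ne'
  have hmem : ∀ z < 0, wave a b k z ∈ waveRange a b := fun z hz =>
    wave_mem_waveRange hab hneg hpos hk hz
  have hopen := isOpen_diffusivity_ne a b
  have hwc : ContinuousOn (wave a b k) (Iio 0 \ {shockPos a b k}) := fun z hz =>
    (hasDerivAt_wave hab hneg hpos hk hz.1 hz.2).1.continuousAt.continuousWithinAt
  have hmaps : MapsTo (wave a b k) (Iio 0 \ {shockPos a b k}) {u | diffusivity a b u ≠ 0} :=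
    fun z hz => hKU (hmem z hz.1)
  have hZc := (contDiffOn_diffusivityZ a b k).continuousOn
  have hZZc := continuousOn_diffusivityZZ a b k
  have hRc := continuousOn_deriv_reaction a b k
  refine ⟨(shockPos_spec hab hneg hpos hk).1, ?_, ?_,
    continuousAt_diffusivity_wave hab hneg hpos hk, hZZc.comp hwc hmaps, hRc.comp hwc hmaps,
    ?_, ?_, ?_, ?_⟩
  · intro z hz hzs
    have := (hasDerivAt_diffusivity a b (wave a b k z)).comp z
      (hasDerivAt_wave hab hneg hpos hk hz hzs).1
    rwa [← (hasDerivAt_diffusivity a b (wave a b k z)).deriv] at this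
  · intro z hz hzs
    have hd : DifferentiableAt ℝ (diffusivityZ a b k) (wave a b k z) :=
      ((contDiffOn_diffusivityZ a b k).contDiffAt
        (hopen.mem_nhds (hKU (hmem z hz)))).differentiableAt (by norm_num)
    exact hd.hasDerivAt.comp z (hasDerivAt_wave hab hneg hpos hk hz hzs).1
  · obtain ⟨C1, hC1⟩ := hK.exists_bound_of_continuousOn (continuous_diffusivity a b).continuousOn
    obtain ⟨C2, hC2⟩ := hK.exists_bound_of_continuousOn (hZc.mono hKU)
    obtain ⟨C3, hC3⟩ := hK.exists_bound_of_continuousOn (hZZc.mono hKU)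
    obtain ⟨C4, hC4⟩ := hK.exists_bound_of_continuousOn (hRc.mono hKU)
    refine ⟨max (max C1 C2) (max C3 C4), fun z hz _ => ⟨?_, ?_, ?_, ?_⟩⟩
    · exact (hC1 _ (hmem z hz)).trans ((le_max_left _ _).trans (le_max_left _ _))
    · exact (hC2 _ (hmem z hz)).trans ((le_max_right _ _).trans (le_max_left _ _))
    · exact (hC3 _ (hmem z hz)).trans ((le_max_left _ _).trans (le_max_right _ _))
    · exact (hC4 _ (hmem z hz)).trans ((le_max_right _ _).trans (le_max_right _ _))
  · obtain ⟨u, hu, hmin⟩ := hK.exists_isMinOn hne (continuous_diffusivity a b).continuousOn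
    exact ⟨_, hDpos u hu, fun z hz => hmin (hmem z hz)⟩
  -- The pointwise strict inequality becomes a uniform gap `δ`, minus the maximum. The endpoint `u =
  -- 1` matters, since `ū` approaches it at `-∞`.
  · obtain ⟨u, hu, hmax⟩ := hK.exists_isMaxOn hne
      (((continuousOn_const (c := (1 / 2 : ℝ))).mul (hZZc.mono hKU)).add (hRc.mono hKU))
    refine ⟨_, neg_pos.2 (hstab u hu), fun z hz _ => ?_⟩
    rw [neg_neg]
    exact hmax (hmem z hz)
  · have hU : shockUpper a b ∈ waveRange a b := Or.inr (left_mem_Icc.2 hr1.le)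
    have hL : shockLower a b ∈ waveRange a b := Or.inl (right_mem_Icc.2 h0.le)
    exact ⟨_, _, ((hZc.continuousAt (hopen.mem_nhds (hKU hU))).tendsto).comp
        (tendsto_wave_left hab hneg hpos hk),
      ((hZc.continuousAt (hopen.mem_nhds (hKU hL))).tendsto).comp
        (tendsto_wave_right hab hneg hpos hk), diffusivityZ_shock_le hab hneg hpos hk⟩

end

end RecedingWave

theorem theorem1 (a b k : ℝ) (ha : 0 < a) (hab : a < b) (hb : b < 1)
    (hneg : b < (a + 2) / 3) (hpos : b < a * (2 + √3)) (hk : 0 < k)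
    (hstab : ∀ u ∈ Set.Icc 0 (RecedingWave.shockLower a b) ∪ Set.Icc (RecedingWave.shockUpper a b) 1,
      1 / 2 * RecedingWave.diffusivityZZ a b k u + deriv (RecedingWave.reaction a b k) u < 0) :
    RecedingWave.SpectrallyStable (RecedingWave.linearisedOperator a b k) := by
  intro μ hμ
  by_contra! hre
  obtain ⟨B, hB, hB'⟩ := (RecedingWave.isDissipative_wave hab hneg hpos hk hstab).exists_resolvent
    (RecedingWave.speed a b k) hre
  refine hμ ⟨B, fun f => ?_, fun p => ?_⟩
  -- For the coefficients along the wave, `IsImage` unfolds to `IsLinearisation`, so the abstract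
  -- resolvent applies directly to the graph of the operator.
  · have h := (RecedingWave.mem_graph_linearisedOperator a b k _ _).2 (hB f)
    obtain ⟨y, hy, hy'⟩ := (LinearPMap.mem_graph_iff _).1 h
    simp only at hy hy'
    refine ⟨hy ▸ y.2, ?_⟩
    rw [show (⟨B f, hy ▸ y.2⟩ : (RecedingWave.linearisedOperator a b k).domain) = y from
      Subtype.ext hy.symm, hy', add_sub_cancel_right]
  · exact hB' _ _ ((RecedingWave.mem_graph_linearisedOperator a b k _ _).1
      ((RecedingWave.linearisedOperator a b k).mem_graph p))
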